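/- (Wirthmüller isomorphism) A tensor-triangulated category is a triangulated category with a compatible closed symmetric monoidal structure $(\otimes,\mathbb 1,\underline{\mathrm{hom}})$ in the sense of Hovey–Palmieri–Strickland. An object $t$ is compact if $\mathrm{Hom}(t,-)$ sends coproducts to coproducts of abelian groups, and rigid if the natural map $\underline{\mathrm{hom}}(t,\mathbb 1)\otimes y\to\underline{\mathrm{hom}}(t,y)$ is an isomorphism for all $y$. The category is rigidly-compactly generated if it has arbitrary coproducts, there is a set $\mathcal G$ of compact objects such that $\mathrm{Hom}(g,t)=0$ for all $g\in\mathcal G$ implies $t=0$, and the compact objects are exactly the rigid objects. Let $\mathcal C,\mathcal D$ be rigidly-compactly generated tensor-triangulated categories and let $f^*:\mathcal D\to\mathcal C$ be a strong symmetric monoidal triangulated functor preserving arbitrary coproducts. Suppose that there are five adjoints $f_{(1)}\dashv f^*\dashv f_*\dashv f^{(1)}\dashv f_{(-1)}$ (Grothendieck–Neeman duality), and put $\omega_f:=f^{(1)}(\mathbb 1)\in\mathcal C$. Then the following are equivalent: (W1) $f_{(1)}$ admits a left adjoint; equivalently, $f_{(1)}$ preserves arbitrary products. (W2) $f_{(-1)}$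 admits a right adjoint; equivalently, $f_{(-1)}$ preserves arbitrary coproducts; equivalently, $f^{(1)}$ preserves compact objects. (W3) $\omega_f$ is compact. (W4) $\omega_f$ is $\otimes$-invertible. (W5) There is a $\otimes$-invertible object $\omega\in\mathcal C$ with $f_{(1)}\cong f_*(\omega\otimes-)$ or, equivalently (for the same $\omega$), with $f_*\cong f_{(1)}(\omega^{-1}\otimes-)$. (W6) There is an infinite tower of adjoints on both sides, that is, there are functors $f^{(n)}:\mathcal D\to\mathcal C$ and $f_{(n)}:\mathcal C\to\mathcal D$ for all $n\in\mathbb Z$ with $f^{(n)}\dashv f_{(-n)}\dashv f^{(n+1)}$ and $f^{(0)}\cong f^*$. All functors in a tower as in (W6) preserve coproducts, products and compact objects. When the conditions hold, any such tower is given, for all $n\in\mathbb Z$, by $f^{(n)}\cong\omega_f^{\otimes n}\otimes f^*(-)$ and $f_{(n)}\cong f_*(\omega_f^{\otimes n}\otimes-)$. Finally, (W1)–(W6) hold as soon as any one of the following holds: (1) $f_*$ is faithful (equivalently, every object of $\mathcal C$ is a direct summand of $f^*(y)$ for some $y\in\mathcal D$); (2) any $x\in\mathcal C$ is compact if $f_*(x)$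 is compact; (3) any $x\in\mathcal C$ is compact if $f_*(x\otimes y)$ is compact for every compact $y\in\mathcal C$. Moreover (1)$\Rightarrow$(2)$\Rightarrow$(3). -/

import Mathlib

open CategoryTheory Category Limits MonoidalCategory Pretriangulated Opposite

universe v u u₁ u₂

namespace TT

section Coproducts

variable {C : Type u₁} [Category.{v} C] {D : Type u₂} [Category.{v} D]

/-- The functor preserves arbitrary (small) coproducts. -/
def PreservesAllCoproducts (F : C ⥤ D) : Prop :=
  ∀ J : Type v, PreservesColimitsOfShape (Discrete J) F

/-- The functor preserves arbitrary (small) products. -/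
def PreservesAllProducts (F : C ⥤ D) : Prop :=
  ∀ J : Type v, PreservesLimitsOfShape (Discrete J) F

end Coproducts

section Compact

variable {C : Type u} [Category.{v} C] [Preadditive C]

/-- An object `t` is compact if `Hom(t, -)`, as a functor to abelian groups, preserves arbitrary
coproducts. -/
def IsCompactObj (t : C) : Prop :=
  PreservesAllCoproducts (preadditiveCoyoneda.obj (op t))

variable (C) in
/-- Existence of arbitrary coproducts and of a set of compact objects `G i` such that
`Hom(G i, t) = 0` for all `i` implies `t = 0`. -/
structure IsCompactlyGenerated : Prop where
  hasCoproducts : HasCoproducts.{v} C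
  exists_generators : ∃ (ι : Type v) (G : ι → C), (∀ i, IsCompactObj (G i)) ∧
    ∀ t : C, (∀ (i : ι) (φ : G i ⟶ t), φ = 0) → IsZero t

end Compact

/-- The functor preserves compact objects. -/
def PreservesCompacts {C : Type u₁} [Category.{v} C] [Preadditive C]
    {D : Type u₂} [Category.{v} D] [Preadditive D] (F : C ⥤ D) : Prop :=
  ∀ x : C, IsCompactObj x → IsCompactObj (F.obj x)

section Monoidal

variable {C : Type u} [Category.{v} C] [MonoidalCategory C]

/-- `x'` is a `⊗`-inverse of `x`; the categories considered below are symmetric, so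
one side is enough. -/
def IsTensorInverse (x x' : C) : Prop := Nonempty (x ⊗ x' ≅ 𝟙_ C)

/-- `⊗`-invertible objects. -/
def IsTensorInvertible (x : C) : Prop := ∃ x' : C, IsTensorInverse x x'

/-- The tensor power `x^{⊗ n}` for a natural number `n`. -/
def tensorPow (x : C) : ℕ → C
  | 0 => 𝟙_ C
  | n + 1 => x ⊗ tensorPow x n

/-- The tensor power `x^{⊗ n}` for an integer `n`, where `x'` is a `⊗`-inverse of `x`. -/
def tensorZPow (x x' : C) : ℤ → C
  | Int.ofNat n => tensorPow x n
  | Int.negSucc n => tensorPow x' (n + 1)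

variable [MonoidalClosed C]

/-- The natural map `hom(x, 𝟙) ⊗ y ⟶ hom(x, y)`, adjoint to
`x ⊗ (hom(x, 𝟙) ⊗ y) ≅ (x ⊗ hom(x, 𝟙)) ⊗ y ⟶ 𝟙 ⊗ y ≅ y`. -/
def dualTensorToHom (x y : C) :
    (ihom x).obj (𝟙_ C) ⊗ y ⟶ (ihom x).obj y :=
  MonoidalClosed.curry
    ((α_ x ((ihom x).obj (𝟙_ C)) y).inv ≫ ((ihom.ev x).app (𝟙_ C) ▷ y) ≫ (λ_ y).hom)

/-- Rigid (strongly dualizable) objects. -/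
def IsRigidObj (x : C) : Prop := ∀ y : C, IsIso (dualTensorToHom x y)

end Monoidal

section TensorTriangulated

variable {C : Type u} [Category.{v} C] [MonoidalCategory C] [SymmetricCategory C]
  [HasShift C ℤ]

/-- `x⟦n⟧ ⊗ y ⟶ (x ⊗ y)⟦n⟧`, deduced by symmetry from
the isomorphisms `y ⊗ x⟦n⟧ ≅ (y ⊗ x)⟦n⟧`. -/
def shiftTensor [∀ x : C, (tensorLeft x).CommShift ℤ] (x y : C) (n : ℤ) :
    x⟦n⟧ ⊗ y ⟶ (x ⊗ y)⟦n⟧ :=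
  (β_ (x⟦n⟧) y).hom ≫ ((tensorLeft y).commShiftIso n).hom.app x ≫ (β_ y x).hom⟦n⟧'

/-- The multiplication `𝟙⟦r⟧ ⊗ 𝟙⟦s⟧ ⟶ 𝟙⟦t⟧` of spheres, for `r + s = t`. -/
def sphereMul [∀ x : C, (tensorLeft x).CommShift ℤ] (r s t : ℤ) (h : r + s = t) :
    (𝟙_ C)⟦r⟧ ⊗ (𝟙_ C)⟦s⟧ ⟶ (𝟙_ C)⟦t⟧ :=
  ((tensorLeft ((𝟙_ C)⟦r⟧)).commShiftIso s).hom.app (𝟙_ C) ≫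
    (ρ_ ((𝟙_ C)⟦r⟧)).hom⟦s⟧' ≫ ((shiftFunctorAdd' C r s t h).inv.app (𝟙_ C))

/-- The canonical map `hom(x, w)⟦-1⟧ ⟶ hom(x⟦1⟧, w)`, adjoint to
`x⟦1⟧ ⊗ hom(x, w)⟦-1⟧ ≅ (x ⊗ hom(x, w)⟦-1⟧)⟦1⟧ ≅ x ⊗ hom(x, w)⟦-1⟧⟦1⟧ ≅ x ⊗ hom(x, w) ⟶ w`. -/
def ihomShift [MonoidalClosed C] [∀ x : C, (tensorLeft x).CommShift ℤ] (x w : C) :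
    ((ihom x).obj w)⟦(-1 : ℤ)⟧ ⟶ (ihom (x⟦(1 : ℤ)⟧)).obj w :=
  MonoidalClosed.curry
    (shiftTensor x (((ihom x).obj w)⟦(-1 : ℤ)⟧) 1 ≫
      ((tensorLeft x).commShiftIso (1 : ℤ)).inv.app (((ihom x).obj w)⟦(-1 : ℤ)⟧) ≫
      (x ◁ (shiftNegShift ((ihom x).obj w) (1 : ℤ)).hom) ≫
      (ihom.ev x).app w)

end TensorTriangulated

/-- A closed symmetric monoidal structure compatible with the triangulation, in the sense of
Hovey, Palmieri and Strickland. -/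
class TensorTriangulated (C : Type u) [Category.{v} C] [Preadditive C] [HasZeroObject C]
    [HasShift C ℤ] [∀ n : ℤ, (shiftFunctor C n).Additive] [Pretriangulated C]
    [MonoidalCategory C] [SymmetricCategory C] [MonoidalClosed C] where
  /-- The isomorphisms `x ⊗ y⟦n⟧ ≅ (x ⊗ y)⟦n⟧`, natural in `y`. -/
  commShift (x : C) : (tensorLeft x).CommShift ℤ
  /-- Naturality in `x`. -/
  commShift_natural {x x' : C} (φ : x ⟶ x') (y : C) (n : ℤ) :
    ((tensorLeft x).commShiftIso n).hom.app y ≫ (φ ▷ y)⟦n⟧' =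
      (φ ▷ (y⟦n⟧)) ≫ ((tensorLeft x').commShiftIso n).hom.app y
  /-- Compatibility with the unit isomorphism. -/
  commShift_unit (y : C) (n : ℤ) :
    ((tensorLeft (𝟙_ C)).commShiftIso n).hom.app y ≫ (λ_ y).hom⟦n⟧' = (λ_ (y⟦n⟧)).hom
  /-- Compatibility with the associativity isomorphism. -/
  commShift_assoc (x y z : C) (n : ℤ) :
    ((tensorLeft (x ⊗ y)).commShiftIso n).hom.app z ≫ (α_ x y z).hom⟦n⟧' =
      (α_ x y (z⟦n⟧)).hom ≫ (x ◁ ((tensorLeft y).commShiftIso n).hom.app z) ≫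
        ((tensorLeft x).commShiftIso n).hom.app (y ⊗ z)
  /-- The tensor product is exact in each variable. -/
  tensor_exact (x : C) : (tensorLeft x).IsTriangulated
  /-- The internal hom is exact in its contravariant variable (with the usual sign). -/
  ihom_exact (T : Triangle C) (hT : T ∈ distTriang C) (w : C) :
    Triangle.mk
      (-(ihomShift T.obj₁ w ≫ (MonoidalClosed.pre T.mor₃).app w))
      ((MonoidalClosed.pre T.mor₂).app w)
      ((MonoidalClosed.pre T.mor₁).app w ≫
        (shiftNegShift ((ihom T.obj₁).obj w) (1 : ℤ)).inv) ∈ distTriang C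
  /-- The symmetry of the tensor product of spheres is graded commutative. -/
  sphere_comm (r s t : ℤ) (h : r + s = t) (h' : s + r = t) :
    (β_ ((𝟙_ C)⟦r⟧) ((𝟙_ C)⟦s⟧)).hom ≫ sphereMul s r t h' =
      (r * s).negOnePow • sphereMul r s t h

attribute [reducible] TensorTriangulated.commShift
attribute [instance] TensorTriangulated.commShift TensorTriangulated.tensor_exact

/-- Compactly generated, and the compact objects are exactly the rigid objects. -/
structure IsRigidlyCompactlyGenerated (C : Type u) [Category.{v} C] [Preadditive C]
    [MonoidalCategory C] [MonoidalClosed C] : Prop where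
  isCompactlyGenerated : IsCompactlyGenerated C
  compact_iff_rigid : ∀ x : C, IsCompactObj x ↔ IsRigidObj x

/-- A doubly infinite tower of adjoints
`⋯ ⊣ up n ⊣ down (-n) ⊣ up (n + 1) ⊣ down (-(n + 1)) ⊣ ⋯` with `up 0 ≅ F`. -/
structure AdjointTower {C : Type u₁} [Category.{v} C] {D : Type u₂} [Category.{v} D]
    (F : D ⥤ C) where
  /-- The functors `f^{(n)}`. -/
  up : ℤ → (D ⥤ C)
  /-- The functors `f_{(n)}`. -/
  down : ℤ → (C ⥤ D)
  upZeroIso : up 0 ≅ F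
  adjUp (n : ℤ) : up n ⊣ down (-n)
  adjDown (n : ℤ) : down (-n) ⊣ up (n + 1)

end TT

/-! Write F, R, U for f^*, f_*, f^{(1)} and ω for U 𝟙. The heart of the proof is an isomorphism F ≅
hom(ω, U -) (`isoIhomDualizing`), valid without assuming any of the equivalent conditions. It is
tested on maps out of a compact x with dual a. Since U has a right adjoint, it preserves coproducts,
so R a is compact and hence rigid. The counit R ω ⟶ 𝟙 and the projection formula make R(ω ⊗ x) a
dual of R a, which gives Hom(x, F y) ≅ Hom(𝟙, a ⊗ F y) ≅ Hom(𝟙, R a ⊗ y) ≅ Hom(R(ω ⊗ x), y) ≅ Hom(x,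
hom(ω, U y)).

Passing to left adjoints yields f_{(1)} ≅ R(ω ⊗ -), and evaluating at 𝟙 yields hom(ω, ω) ≅ 𝟙. Thus ω
is invertible once hom(ω, 𝟙) ⊗ ω ⟶ hom(ω, ω) is an isomorphism. If ω is compact, this is rigidity.
If f_{(1)} preserves products, so does Hom(d, - ⊗ ω) for compact d, and
`isIso_dualTensorToHom_of_preserves` extends the isomorphism hom(z, 𝟙) ⊗ ω ≅ hom(z, ω) from compact
z to all z, in particular to ω.

Conversely, if ω is invertible, then U ≅ ω ⊗ F -, and twisting F and R by powers of ω produces the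
whole tower (`twistTower`), which is unique because adjoints are. No representability theorem is
needed: the adjoints are constructed explicitly.

The sufficient conditions all reduce to the third one, applied to ω: f_{(1)} preserves compact
objects because F preserves coproducts, so R(ω ⊗ y) is compact for every compact y. -/

namespace TT

/-! ### Compact objects and maps into coproducts -/

section CompactBasics

/-- A retract of a functor preserving colimits of a given shape preserves them. -/
lemma preservesColimitsOfShape_of_retract {A : Type*} [Category* A] {B : Type*} [Category* B]
    {J : Type*} [Category* J] {F G : A ⥤ B} (i : F ⟶ G) (r : G ⟶ F) (h : i ≫ r = 𝟙 F)
    [PreservesColimitsOfShape J G] : PreservesColimitsOfShape J F where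
  preservesColimit {K} :=
    { preserves {c} hc := by
        have hG := isColimitOfPreserves G hc
        have hr (X : A) : i.app X ≫ r.app X = 𝟙 _ := by rw [← NatTrans.comp_app, h]; rfl
        refine ⟨{ desc := fun s => i.app c.pt ≫ hG.desc
                    ((Cocone.precompose (Functor.whiskerLeft K r)).obj s)
                  fac := fun s j => ?_
                  uniq := fun s m hm => ?_ }⟩
        · have h1 := hG.fac ((Cocone.precompose (Functor.whiskerLeft K r)).obj s) j
          dsimp at h1 ⊢
          rw [← assoc, i.naturality, assoc, h1, ← assoc, hr, id_comp]
        · have h2 : r.app c.pt ≫ m = hG.desc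
              ((Cocone.precompose (Functor.whiskerLeft K r)).obj s) := by
            refine hG.hom_ext fun j => ?_
            rw [hG.fac]
            have := hm j
            dsimp at this ⊢
            rw [← assoc, r.naturality, assoc, this]
          rw [← h2, ← assoc, hr]
          exact (id_comp m).symm }

variable {C : Type u₁} [Category.{v} C] [Preadditive C]

lemma IsCompactObj.of_retract {x y : C} (hy : IsCompactObj y) (r : Retract x y) :
    IsCompactObj x := fun J => by
  have := hy J
  refine preservesColimitsOfShape_of_retract
    (preadditiveCoyoneda.map r.r.op) (preadditiveCoyoneda.map r.i.op) ?_
  rw [← Functor.map_comp, ← op_comp, r.retract]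
  simp

lemma IsCompactObj.of_iso {x y : C} (hy : IsCompactObj y) (e : x ≅ y) : IsCompactObj x :=
  hy.of_retract ⟨e.hom, e.inv, e.hom_inv_id⟩

/-- A map from a compact object to a coproduct is a finite sum of maps to the summands. -/
lemma IsCompactObj.exists_finset_sum {t : C} (ht : IsCompactObj t) {J : Type v} {X : J → C}
    {c : Cofan X} (hc : IsColimit c) (f : t ⟶ c.pt) :
    ∃ (S : Finset J) (g : ∀ j, t ⟶ X j), f = ∑ j ∈ S, g j ≫ c.inj j := by
  classical
  have := ht J
  have hF := isColimitOfPreserves (preadditiveCoyoneda.obj (op t)) hc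
  let H : AddSubgroup (t ⟶ c.pt) :=
    { carrier := {f | ∃ (S : Finset J) (g : ∀ j, t ⟶ X j), f = ∑ j ∈ S, g j ≫ c.inj j}
      zero_mem' := ⟨∅, fun _ => 0, by simp⟩
      add_mem' := by
        rintro _ _ ⟨S, g, rfl⟩ ⟨S', g', rfl⟩
        refine ⟨S ∪ S', fun j => (if j ∈ S then g j else 0) + (if j ∈ S' then g' j else 0), ?_⟩
        simp only [Preadditive.add_comp, Finset.sum_add_distrib]
        congr 1
        · rw [← Finset.sum_subset Finset.subset_union_left (f := fun j =>
            (if j ∈ S then g j else 0) ≫ c.inj j)]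
          · exact Finset.sum_congr rfl fun j hj => by simp [hj]
          · intro j _ hj; simp [hj]
        · rw [← Finset.sum_subset Finset.subset_union_right (f := fun j =>
            (if j ∈ S' then g' j else 0) ≫ c.inj j)]
          · exact Finset.sum_congr rfl fun j hj => by simp [hj]
          · intro j _ hj; simp [hj]
      neg_mem' := by
        rintro _ ⟨S, g, rfl⟩
        exact ⟨S, fun j => -g j, by simp⟩ }
  let q : (preadditiveCoyoneda.obj (op t)).obj c.pt ⟶ AddCommGrpCat.of ((t ⟶ c.pt) ⧸ H) :=
    AddCommGrpCat.ofHom (QuotientAddGroup.mk' H)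
  -- The image of `c` is a coproduct of abelian groups, so it is enough that `q` kills each summand.
  have hq : q = 0 := by
    refine hF.hom_ext fun ⟨j⟩ => ?_
    ext (g : t ⟶ X j)
    refine (QuotientAddGroup.eq_zero_iff (g ≫ c.inj j)).2 ⟨{j}, fun k => if h : k = j then
      g ≫ eqToHom (by rw [h]) else 0, by simp⟩
  exact (QuotientAddGroup.eq_zero_iff f).1 (ConcreteCategory.congr_hom hq f)

end CompactBasics

/-! ### Adjunctions and compactness -/

section Adjunctions

variable {C : Type u₁} [Category.{v} C] {D : Type u₂} [Category.{v} D]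

lemma PreservesAllCoproducts.of_isLeftAdjoint (F : C ⥤ D) [F.IsLeftAdjoint] :
    PreservesAllCoproducts F := fun _ => inferInstance

lemma PreservesAllProducts.of_isRightAdjoint (F : C ⥤ D) [F.IsRightAdjoint] :
    PreservesAllProducts F := fun _ => inferInstance

variable [Preadditive C] [HasZeroObject C] [Preadditive D] [HasZeroObject D]

lemma additive_of_isRightAdjoint [HasBinaryBiproducts D] (R : D ⥤ C) [R.IsRightAdjoint] :
    R.Additive := by
  have : R.PreservesZeroMorphisms := inferInstance
  have := preservesBinaryBiproducts_of_preservesBinaryProducts R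
  exact Functor.additive_of_preservesBinaryBiproducts R

variable [HasBinaryBiproducts D]

/-- For an adjunction `L ⊣ R`, the isomorphism `Hom(L x, -) ≅ Hom(x, R -)` of functors to abelian
groups. -/
noncomputable def preadditiveCoyonedaAdjIso {L : C ⥤ D} {R : D ⥤ C} (adj : L ⊣ R) (x : C) :
    preadditiveCoyoneda.obj (op (L.obj x)) ≅ R ⋙ preadditiveCoyoneda.obj (op x) :=
  have := adj.isRightAdjoint
  have := additive_of_isRightAdjoint R
  have h (y : D) (f g : L.obj x ⟶ y) :
      adj.homEquiv x y (f + g) = adj.homEquiv x y f + adj.homEquiv x y g := by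
    simp [Adjunction.homEquiv_unit]
  NatIso.ofComponents (fun y => AddEquiv.toAddCommGrpIso
    { adj.homEquiv x y with
      map_add' := h y })
    (fun {y y'} f => by
      ext (g : L.obj x ⟶ y)
      exact adj.homEquiv_naturality_right g f)

/-- Hom(L x, -) ≅ Hom(x, R -) is a composite of two coproduct-preserving functors. -/
lemma PreservesCompacts.of_adjunction {L : C ⥤ D} {R : D ⥤ C} (adj : L ⊣ R)
    (hR : PreservesAllCoproducts R) : PreservesCompacts L := fun x hx J => by
  have := hR J
  have := hx J
  exact preservesColimitsOfShape_of_natIso (preadditiveCoyonedaAdjIso adj x).symm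

end Adjunctions

section Shift

variable {C : Type u} [Category.{v} C] [Preadditive C] [HasZeroObject C] [HasBinaryBiproducts C]
  [HasShift C ℤ]

lemma IsCompactObj.shift {x : C} (hx : IsCompactObj x) (n : ℤ) : IsCompactObj (x⟦n⟧) :=
  PreservesCompacts.of_adjunction (shiftEquiv C n).toAdjunction
    (fun _ => (inferInstance : PreservesColimitsOfShape _ (shiftFunctor C (-n)))) x hx

end Shift

/-! ### Sequential telescopes -/

section Telescope

variable {C : Type u} [Category.{v} C] [Preadditive C] [HasCoproducts.{v} C]
  {Y : ℕ → C} (s : ∀ n, Y n ⟶ Y (n + 1))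

variable (Y) in
/-- The countable coproduct of a sequence of objects. -/
noncomputable abbrev seqCoproduct : C := ∐ fun n : ULift.{v} ℕ => Y n.down

variable (Y) in
/-- The inclusion of a summand in a countable coproduct. -/
noncomputable abbrev seqι (n : ℕ) : Y n ⟶ seqCoproduct.{v} Y :=
  Sigma.ι (fun n : ULift.{v} ℕ => Y n.down) ⟨n⟩

/-- The map `1 - shift` on the countable coproduct of a sequence. -/
noncomputable def oneSubShift : seqCoproduct.{v} Y ⟶ seqCoproduct.{v} Y :=
  Sigma.desc fun n => seqι Y n.down - s n.down ≫ seqι Y (n.down + 1)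

lemma seqι_oneSubShift (n : ℕ) :
    seqι Y n ≫ oneSubShift s = seqι Y n - s n ≫ seqι Y (n + 1) := by
  simp [seqι, oneSubShift]

lemma seqι_oneSubShift_assoc (n : ℕ) {Z : C} (h : seqCoproduct.{v} Y ⟶ Z) :
    seqι Y n ≫ oneSubShift s ≫ h = (seqι Y n - s n ≫ seqι Y (n + 1)) ≫ h := by
  rw [← assoc, seqι_oneSubShift]

variable (Y) in
/-- The projection to a summand of a countable coproduct. -/
noncomputable def seqπ (m : ℕ) : seqCoproduct.{v} Y ⟶ Y m :=
  Sigma.desc fun n => if h : n.down = m then eqToHom (by rw [h]) else 0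

lemma seqι_seqπ_self (m : ℕ) : seqι Y m ≫ seqπ Y m = 𝟙 _ := by
  simp [seqι, seqπ]

lemma seqι_seqπ_of_ne {n m : ℕ} (h : n ≠ m) : seqι Y n ≫ seqπ Y m = 0 := by
  simp [seqι, seqπ, h]

lemma oneSubShift_seqπ_zero : oneSubShift s ≫ seqπ Y 0 = seqπ Y 0 := by
  refine Sigma.hom_ext _ _ fun ⟨n⟩ => ?_
  change seqι Y n ≫ _ = seqι Y n ≫ _
  rw [seqι_oneSubShift_assoc, Preadditive.sub_comp, assoc,
    seqι_seqπ_of_ne (n := n + 1) (by lia), comp_zero, sub_zero]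

lemma oneSubShift_seqπ_succ (m : ℕ) :
    oneSubShift s ≫ seqπ Y (m + 1) = seqπ Y (m + 1) - seqπ Y m ≫ s m := by
  refine Sigma.hom_ext _ _ fun ⟨n⟩ => ?_
  change seqι Y n ≫ _ = seqι Y n ≫ _
  rw [seqι_oneSubShift_assoc, Preadditive.sub_comp, Preadditive.comp_sub, assoc]
  by_cases h : n = m
  · subst h
    rw [seqι_seqπ_self, reassoc_of% (seqι_seqπ_self (Y := Y) n), comp_id]
  · rw [seqι_seqπ_of_ne (n := n + 1) (by lia), reassoc_of% (seqι_seqπ_of_ne (Y := Y) h)]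
    simp

/-- Component m + 1 of the composite is h_{m+1} - h_m ≫ s_m and component 0 is h_0, so all
components of `h` vanish by induction. Compactness of `d` ensures that the components determine `h`.
-/
lemma eq_zero_of_comp_oneSubShift {d : C} (hd : IsCompactObj d) (h : d ⟶ seqCoproduct.{v} Y)
    (hh : h ≫ oneSubShift s = 0) : h = 0 := by
  have hπ (m : ℕ) : h ≫ seqπ Y m = 0 := by
    induction m with
    | zero => rw [← oneSubShift_seqπ_zero s, reassoc_of% hh, zero_comp]
    | succ m ih =>
      have := oneSubShift_seqπ_succ s m
      rw [eq_sub_iff_add_eq] at this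
      rw [← this, Preadditive.comp_add, reassoc_of% hh, reassoc_of% ih]
      simp
  obtain ⟨S, g, hg⟩ := hd.exists_finset_sum (colimit.isColimit _) h
  have hg0 (n) (hn : n ∈ S) : g n = 0 := by
    have h1 := hπ n.down
    rw [hg, Preadditive.sum_comp, Finset.sum_eq_single n] at h1
    · rw [assoc] at h1
      have h2 := seqι_seqπ_self (Y := Y) n.down
      change g n ≫ seqι Y n.down ≫ _ = 0 at h1
      rwa [h2, comp_id] at h1
    · intro m _ hm
      rw [assoc]
      have h2 := seqι_seqπ_of_ne (Y := Y) (n := m.down) (m := n.down)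
        (fun h => hm (ULift.down_injective h))
      change g m ≫ seqι Y m.down ≫ _ = 0
      rw [h2, comp_zero]
    · exact fun h => absurd hn h
  rw [hg]
  exact Finset.sum_eq_zero fun n hn => by rw [hg0 n hn, zero_comp]

/-- After composing with `a`, a map to stage n agrees with its image at any later stage, so the
finitely many components can be pushed to a common stage and added. -/
lemma exists_comp_eq_of_isCompactObj {d W : C} (hd : IsCompactObj d) (a : seqCoproduct.{v} Y ⟶ W)
    (ha : oneSubShift s ≫ a = 0) (f : d ⟶ seqCoproduct.{v} Y) :
    ∃ (N : ℕ) (g : d ⟶ Y N), f ≫ a = g ≫ seqι Y N ≫ a := by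
  have hs (n : ℕ) : seqι Y n ≫ a = s n ≫ seqι Y (n + 1) ≫ a := by
    have := seqι_oneSubShift_assoc s n a
    rw [ha, comp_zero, Preadditive.sub_comp, assoc] at this
    exact (sub_eq_zero.1 this.symm)
  have push (n k : ℕ) (g : d ⟶ Y n) :
      ∃ g' : d ⟶ Y (n + k), g ≫ seqι Y n ≫ a = g' ≫ seqι Y (n + k) ≫ a := by
    induction k with
    | zero => exact ⟨g, rfl⟩
    | succ k ih =>
      obtain ⟨g', hg'⟩ := ih
      exact ⟨g' ≫ s (n + k), by rw [hg', hs, assoc]; rfl⟩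
  have push' (n m : ℕ) (h : n ≤ m) (g : d ⟶ Y n) :
      ∃ g' : d ⟶ Y m, g ≫ seqι Y n ≫ a = g' ≫ seqι Y m ≫ a := by
    obtain ⟨k, rfl⟩ := Nat.exists_eq_add_of_le h
    exact push n k g
  obtain ⟨S, g, rfl⟩ := hd.exists_finset_sum (colimit.isColimit _) f
  classical
  induction S using Finset.induction_on with
  | empty => exact ⟨0, 0, by simp⟩
  | insert n S hn ih =>
    obtain ⟨N, g₁, hg₁⟩ := ih
    obtain ⟨g₂, hg₂⟩ := push' N (max N n.down) (le_max_left _ _) g₁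
    obtain ⟨g₃, hg₃⟩ := push' n.down (max N n.down) (le_max_right _ _) (g n)
    refine ⟨max N n.down, g₃ + g₂, ?_⟩
    rw [Finset.sum_insert hn, Preadditive.add_comp, Preadditive.add_comp, hg₁, hg₂, ← hg₃, assoc]
    rfl

end Telescope

lemma exists_eq_shift_map {C : Type u} [Category.{v} C] [HasShift C ℤ] {d X : C}
    (h : d ⟶ X⟦(1 : ℤ)⟧) :
    ∃ k : d⟦(-1 : ℤ)⟧ ⟶ X, h = (shiftNegShift d (1 : ℤ)).inv ≫ k⟦(1 : ℤ)⟧' := by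
  obtain ⟨k, hk⟩ := (shiftFunctor C (1 : ℤ)).map_surjective ((shiftNegShift d (1 : ℤ)).hom ≫ h)
  exact ⟨k, by rw [hk]; simp⟩

/-! ### Generation by compact objects -/

section Localizing

variable {C : Type u} [Category.{v} C] [Preadditive C] [HasZeroObject C] [HasShift C ℤ]
  [∀ n : ℤ, (shiftFunctor C n).Additive] [Pretriangulated C]

/-- A map is an isomorphism if it induces bijections on maps from all shifts of a family of objects
detecting zero objects. -/
lemma isIso_of_bijective_comp {ι : Type*} {G : ι → C}
    (hG : ∀ t : C, (∀ (i : ι) (φ : G i ⟶ t), φ = 0) → IsZero t) {X Y : C} (f : X ⟶ Y)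
    (hf : ∀ (i : ι) (n : ℤ), Function.Bijective (fun φ : (G i)⟦n⟧ ⟶ X => φ ≫ f)) : IsIso f := by
  obtain ⟨Z, g, h, hT⟩ := distinguished_cocone_triangle f
  have hfg : f ≫ g = 0 := comp_distTriang_mor_zero₁₂ _ hT
  have hhf : h ≫ f⟦(1 : ℤ)⟧' = 0 := comp_distTriang_mor_zero₃₁ _ hT
  refine (Triangle.isZero₃_iff_isIso₁ _ hT).1 (hG _ fun i φ => ?_)
  change G i ⟶ Z at φ
  -- φ ≫ h is the shift of a map `k` from (G i)⟦-1⟧ killed by `f`, so injectivity in degree -1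
  -- applies; surjectivity in degree 0 then finishes.
  have h0 : φ ≫ h = 0 := by
    obtain ⟨k, hk⟩ := exists_eq_shift_map (φ ≫ h)
    have hkf : k ≫ f = 0 := by
      refine (shiftFunctor C (1 : ℤ)).map_injective ?_
      rw [← cancel_epi (shiftNegShift (G i) (1 : ℤ)).inv, Functor.map_comp, ← assoc, ← hk, assoc,
        hhf, comp_zero, Functor.map_zero]
      exact comp_zero.symm
    have hk0 : k = 0 := (hf i (-1)).1 (by simpa using hkf)
    rw [hk, hk0, Functor.map_zero]
    exact comp_zero
  obtain ⟨ψ, rfl⟩ := Triangle.coyoneda_exact₃ _ hT φ h0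
  change G i ⟶ Y at ψ
  obtain ⟨χ, hχ⟩ := (hf i 0).2 (((shiftFunctorZero C ℤ).hom.app (G i)) ≫ ψ)
  have : ψ = (shiftFunctorZero C ℤ).inv.app (G i) ≫ χ ≫ f := by
    dsimp at hχ
    rw [hχ]
    simp
  change ψ ≫ g = 0
  rw [this, assoc, assoc, hfg, comp_zero]
  exact comp_zero

lemma IsCompactlyGenerated.isIso_of_bijective_comp (hC : IsCompactlyGenerated C) {X Y : C}
    (f : X ⟶ Y)
    (hf : ∀ d : C, IsCompactObj d → Function.Bijective (fun φ : d ⟶ X => φ ≫ f)) : IsIso f := by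
  obtain ⟨ι, G, hG, hG'⟩ := hC.exists_generators
  exact TT.isIso_of_bijective_comp hG' f fun i n => hf _ ((hG i).shift n)

/-- A sequence over `t` which is surjective on maps from generators, and in which every map from a
generator vanishing in `t` vanishes at the next stage, has telescope `t`. -/
lemma exists_distTriang_oneSubShift {ι : Type*} {G : ι → C} (hGc : ∀ i, IsCompactObj (G i))
    (hG : ∀ t : C, (∀ (i : ι) (φ : G i ⟶ t), φ = 0) → IsZero t) [HasCoproducts.{v} C]
    {Y : ℕ → C} (s : ∀ n, Y n ⟶ Y (n + 1)) {t : C} (q : ∀ n, Y n ⟶ t)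
    (hq : ∀ n, s n ≫ q (n + 1) = q n)
    (hsurj : ∀ (i : ι) (n : ℤ) (f : (G i)⟦n⟧ ⟶ t), ∃ f', f' ≫ q 0 = f)
    (hker : ∀ (i : ι) (n : ℤ) (N : ℕ) (f : (G i)⟦n⟧ ⟶ Y N), f ≫ q N = 0 → f ≫ s N = 0) :
    ∃ T ∈ distTriang C, T.obj₁ = seqCoproduct.{v} Y ∧ T.obj₂ = seqCoproduct.{v} Y ∧
      Nonempty (T.obj₃ ≅ t) := by
  obtain ⟨W, a, b, hT⟩ := distinguished_cocone_triangle (oneSubShift s)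
  have ha : oneSubShift s ≫ a = 0 := comp_distTriang_mor_zero₁₂ _ hT
  have hb : b ≫ (oneSubShift s)⟦(1 : ℤ)⟧' = 0 := comp_distTriang_mor_zero₃₁ _ hT
  have hdesc : oneSubShift s ≫ Sigma.desc (fun n : ULift.{v} ℕ => q n.down) = 0 := by
    refine Sigma.hom_ext _ _ fun ⟨n⟩ => ?_
    change seqι Y n ≫ _ = _
    rw [seqι_oneSubShift_assoc, Preadditive.sub_comp]
    simp [seqι, hq]
  obtain ⟨w, hw⟩ := Triangle.yoneda_exact₂ _ hT _ hdesc
  change W ⟶ t at w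
  change _ = a ≫ w at hw
  have hιw (n : ℕ) : seqι Y n ≫ a ≫ w = q n := by rw [← hw]; simp [seqι]
  refine ⟨_, hT, rfl, rfl, ?_⟩
  suffices hw : IsIso w from ⟨@asIso _ _ _ _ w hw⟩
  refine TT.isIso_of_bijective_comp hG w fun i n => ⟨fun f₁ f₂ hf => ?_, fun f => ?_⟩
  · have hd := (hGc i).shift n
    obtain ⟨f, hf₁⟩ : ∃ f, f = f₁ - f₂ := ⟨_, rfl⟩
    have hfw : f ≫ w = 0 := by
      rw [hf₁, Preadditive.sub_comp]
      exact sub_eq_zero.2 hf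
    suffices f = 0 by rwa [hf₁, sub_eq_zero] at this
    -- Since `oneSubShift s` is injective on maps from compact objects, `f` lifts to the coproduct
    -- and is represented at a finite stage N. There it dies in `t`, hence already at stage N + 1.
    have hfb : f ≫ b = 0 := by
      obtain ⟨k, hk⟩ := exists_eq_shift_map (f ≫ b)
      have hk0 : k ≫ oneSubShift s = 0 := by
        refine (shiftFunctor C (1 : ℤ)).map_injective ?_
        rw [← cancel_epi (shiftNegShift ((G i)⟦n⟧) (1 : ℤ)).inv, Functor.map_comp, ← assoc, ← hk,
          assoc, hb, comp_zero, Functor.map_zero]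
        exact comp_zero.symm
      rw [hk, eq_zero_of_comp_oneSubShift s (hd.shift (-1)) k hk0, Functor.map_zero]
      exact comp_zero
    obtain ⟨f', hf'⟩ := Triangle.coyoneda_exact₃ _ hT f hfb
    change _ ⟶ seqCoproduct.{v} Y at f'
    change f = f' ≫ a at hf'
    obtain ⟨N, g, hg⟩ := exists_comp_eq_of_isCompactObj s hd a ha f'
    have hgq : g ≫ q N = 0 := by
      rw [← hιw N, ← assoc (seqι Y N), ← assoc, ← hg, ← hf', hfw]
    have hs : seqι Y N ≫ a = s N ≫ seqι Y (N + 1) ≫ a := by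
      have := seqι_oneSubShift_assoc s N a
      rw [ha, comp_zero, Preadditive.sub_comp, assoc] at this
      exact (sub_eq_zero.1 this.symm)
    rw [hf', hg, hs, ← assoc, hker i n N g hgq, zero_comp]
  · obtain ⟨f', rfl⟩ := hsurj i n f
    exact ⟨f' ≫ seqι Y 0 ≫ a, by simp [hιw]⟩

/-- Every object of a compactly generated triangulated category belongs to any class of objects
containing the compact objects and closed under coproducts and cones. -/
theorem IsCompactlyGenerated.induction (hC : IsCompactlyGenerated C) [HasCoproducts.{v} C]
    (P : C → Prop) (hiso : ∀ {x y : C}, (x ≅ y) → P x → P y) (hcpt : ∀ x, IsCompactObj x → P x)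
    (hcoprod : ∀ (J : Type v) (X : J → C), (∀ j, P (X j)) → P (∐ X))
    (hcone : ∀ T ∈ distTriang C, P T.obj₁ → P T.obj₂ → P T.obj₃) (t : C) : P t := by
  obtain ⟨ι, G, hGc, hG⟩ := hC.exists_generators
  have hcell (κ : Type v) (i : κ → ι) (n : κ → ℤ) : P (∐ fun k => (G (i k))⟦n k⟧) :=
    hcoprod _ _ fun k => hcpt _ ((hGc _).shift _)
  -- Cone off, all at once, every map from a shifted generator to A that dies in `t`.
  have step (A : {A : Over t // P A.left}) : ∃ (B : {B : Over t // P B.left}) (σ : A.1 ⟶ B.1),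
      ∀ (i : ι) (n : ℤ) (f : (G i)⟦n⟧ ⟶ A.1.left), f ≫ A.1.hom = 0 → f ≫ σ.left = 0 := by
    obtain ⟨A, hA⟩ := A
    let κ : Type v := Σ (i : ι) (n : ULift.{v} ℤ), {f : (G i)⟦n.down⟧ ⟶ A.left // f ≫ A.hom = 0}
    let d : (∐ fun k : κ => (G k.1)⟦k.2.1.down⟧) ⟶ A.left := Sigma.desc fun k => k.2.2.1
    obtain ⟨W, a, b, hT⟩ := distinguished_cocone_triangle d
    have hda : d ≫ a = 0 := comp_distTriang_mor_zero₁₂ _ hT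
    have hd : d ≫ A.hom = 0 := Sigma.hom_ext _ _ fun k => by simp [d, k.2.2.2]
    obtain ⟨w, hw⟩ := Triangle.yoneda_exact₂ _ hT _ hd
    change W ⟶ t at w
    change A.hom = a ≫ w at hw
    refine ⟨⟨Over.mk w, hcone _ hT (hcell κ _ _) hA⟩, Over.homMk a hw.symm, fun i n f hf => ?_⟩
    have : f = Sigma.ι (fun k : κ => (G k.1)⟦k.2.1.down⟧) ⟨i, ⟨n⟩, ⟨f, hf⟩⟩ ≫ d := by simp [d]
    change f ≫ a = 0
    rw [this, assoc, hda, comp_zero]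
  choose next σ hσ using step
  -- The initial stage has one cell for each map from a shifted generator to `t`, which gives
  -- surjectivity at stage 0.
  let κ₀ : Type v := Σ (i : ι) (n : ULift.{v} ℤ), ((G i)⟦n.down⟧ ⟶ t)
  let A₀ : {A : Over t // P A.left} :=
    ⟨Over.mk (Sigma.desc fun k => k.2.2 : (∐ fun k : κ₀ => (G k.1)⟦k.2.1.down⟧) ⟶ t),
      hcell κ₀ _ _⟩
  let A (n : ℕ) : {A : Over t // P A.left} := next^[n] A₀
  have hA (n : ℕ) : A (n + 1) = next (A n) := Function.iterate_succ_apply' _ _ _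
  have hs (n : ℕ) : ∃ s : (A n).1 ⟶ (A (n + 1)).1, ∀ (i : ι) (m : ℤ)
      (f : (G i)⟦m⟧ ⟶ (A n).1.left), f ≫ (A n).1.hom = 0 → f ≫ s.left = 0 := by
    rw [hA]
    exact ⟨_, hσ _⟩
  choose s hs using hs
  obtain ⟨T, hT, h₁, h₂, ⟨e⟩⟩ := exists_distTriang_oneSubShift hGc hG (fun n => (s n).left)
    (fun n => (A n).1.hom) (fun n => Over.w (s n))
    (fun i n f => ⟨Sigma.ι (fun k : κ₀ => (G k.1)⟦k.2.1.down⟧) ⟨i, ⟨n⟩, f⟩, by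
      change _ ≫ Sigma.desc _ = f
      simp⟩)
    (fun i n N f hf => hs N i n f hf)
  have hP : P (seqCoproduct.{v} fun n => (A n).1.left) := hcoprod _ _ fun n => (A n.down).2
  exact hiso e (hcone T hT (by rwa [h₁]) (by rwa [h₂]))

end Localizing

/-! ### Extending isomorphisms along colimits, limits and triangles -/

section ColimitTransformation

variable {A : Type*} [Category* A] {B : Type*} [Category* B] {J : Type*} [Category* J]
  {F G : A ⥤ B} (τ : F ⟶ G)

lemma isIso_app_of_isColimit {K : J ⥤ A} {c : Cocone K} (hc : IsColimit c)
    [PreservesColimit K F] [PreservesColimit K G] (h : ∀ j, IsIso (τ.app (K.obj j))) :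
    IsIso (τ.app c.pt) := by
  have : ∀ j, IsIso ((Functor.whiskerLeft K τ).app j) := h
  have := NatIso.isIso_of_isIso_app (Functor.whiskerLeft K τ)
  let e := (isColimitOfPreserves F hc).coconePointsIsoOfNatIso (isColimitOfPreserves G hc)
    (asIso (Functor.whiskerLeft K τ))
  have : τ.app c.pt = e.hom := (isColimitOfPreserves F hc).hom_ext fun j => by
    rw [IsColimit.comp_coconePointsIsoOfNatIso_hom]
    exact τ.naturality _
  rw [this]
  infer_instance

lemma isIso_app_of_isLimit {K : J ⥤ A} {c : Cone K} (hc : IsLimit c)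
    [PreservesLimit K F] [PreservesLimit K G] (h : ∀ j, IsIso (τ.app (K.obj j))) :
    IsIso (τ.app c.pt) := by
  have : ∀ j, IsIso ((Functor.whiskerLeft K τ).app j) := h
  have := NatIso.isIso_of_isIso_app (Functor.whiskerLeft K τ)
  let e := (isLimitOfPreserves F hc).conePointsIsoOfNatIso (isLimitOfPreserves G hc)
    (asIso (Functor.whiskerLeft K τ))
  have : τ.app c.pt = e.hom := (isLimitOfPreserves G hc).hom_ext fun j => by
    rw [IsLimit.conePointsIsoOfNatIso_hom_comp]
    exact (τ.naturality _).symm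
  rw [this]
  infer_instance

lemma isIso_app_of_iso {x y : A} (e : x ≅ y) (h : IsIso (τ.app x)) : IsIso (τ.app y) := by
  have : τ.app y = F.map e.inv ≫ τ.app x ≫ G.map e.hom := by simp
  rw [this]
  infer_instance

end ColimitTransformation

section ExactTransformation

variable {C : Type u₁} [Category.{v} C] [Preadditive C] [HasZeroObject C] [HasShift C ℤ]
  [∀ n : ℤ, (shiftFunctor C n).Additive] [Pretriangulated C]

lemma function_exact_of_isHomological (H : C ⥤ AddCommGrpCat.{v}) [H.IsHomological]
    {T : Triangle C} (hT : T ∈ distTriang C) :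
    Function.Exact (H.map T.mor₁).hom (H.map T.mor₂).hom :=
  (ShortComplex.ab_exact_iff_function_exact _).1 (H.map_distinguished_exact T hT)

lemma isIso_iff_bijective_hom {X Y : AddCommGrpCat.{v}} (f : X ⟶ Y) :
    IsIso f ↔ Function.Bijective f.hom :=
  ConcreteCategory.isIso_iff_bijective f

/-- The five lemma for a transformation of homological functors. -/
lemma isIso_app_obj₃_of_isHomological {H K : C ⥤ AddCommGrpCat.{v}} [H.IsHomological]
    [K.IsHomological] (τ : H ⟶ K) {T : Triangle C} (hT : T ∈ distTriang C)
    (h₁ : IsIso (τ.app T.obj₁)) (h₂ : IsIso (τ.app T.obj₂))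
    (h₁' : IsIso (τ.app (T.obj₁⟦(1 : ℤ)⟧))) (h₂' : IsIso (τ.app (T.obj₂⟦(1 : ℤ)⟧))) :
    IsIso (τ.app T.obj₃) := by
  have hT' := rot_of_distTriang _ hT
  have hT'' := rot_of_distTriang _ hT'
  have hc {x y : C} (f : x ⟶ y) : (K.map f).hom.comp (τ.app x).hom =
      (τ.app y).hom.comp (H.map f).hom := by
    rw [← AddCommGrpCat.hom_comp, ← AddCommGrpCat.hom_comp, τ.naturality]
  rw [isIso_iff_bijective_hom] at *
  exact AddMonoidHom.bijective_of_surjective_of_bijective_of_bijective_of_injective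
    (H.map T.mor₁).hom (H.map T.mor₂).hom (H.map T.mor₃).hom (H.map T.rotate.rotate.mor₂).hom
    (K.map T.mor₁).hom (K.map T.mor₂).hom (K.map T.mor₃).hom (K.map T.rotate.rotate.mor₂).hom
    (τ.app _).hom (τ.app _).hom (τ.app _).hom (τ.app _).hom (τ.app _).hom
    (hc _) (hc _) (hc _) (hc _)
    (function_exact_of_isHomological H hT) (function_exact_of_isHomological H hT')
    (function_exact_of_isHomological H hT'')
    (function_exact_of_isHomological K hT) (function_exact_of_isHomological K hT')
    (function_exact_of_isHomological K hT'')
    h₁.2 h₂ h₁' h₂'.1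

variable {D : Type u₂} [Category.{v} D] [Preadditive D] [HasZeroObject D] [HasShift D ℤ]
  [∀ n : ℤ, (shiftFunctor D n).Additive] [Pretriangulated D]

lemma IsCompactlyGenerated.isIso_iff_isIso_map (hD : IsCompactlyGenerated D) {X Y : D}
    (f : X ⟶ Y) : IsIso f ↔
      ∀ d : D, IsCompactObj d → IsIso ((preadditiveCoyoneda.obj (op d)).map f) := by
  refine ⟨fun _ _ _ => inferInstance, fun h => hD.isIso_of_bijective_comp f fun d hd => ?_⟩
  exact (isIso_iff_bijective_hom _).1 (h d hd)

/-- A transformation between coproduct-preserving triangulated functors is an isomorphism if it is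
so on compact objects. -/
theorem IsCompactlyGenerated.isIso_app (hC : IsCompactlyGenerated C)
    (hD : IsCompactlyGenerated D) {F G : C ⥤ D} [F.CommShift ℤ] [F.IsTriangulated]
    [G.CommShift ℤ] [G.IsTriangulated] (hF : PreservesAllCoproducts F)
    (hG : PreservesAllCoproducts G) (τ : F ⟶ G)
    (hτ : ∀ x, IsCompactObj x → IsIso (τ.app x)) (x : C) : IsIso (τ.app x) := by
  have := hC.hasCoproducts
  -- `τ` is not assumed to commute with shifts, so all shifts are carried through the induction. The
  -- cone step uses the five lemma after applying Hom(d, -), not a morphism of triangles.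
  suffices h : ∀ n : ℤ, IsIso (τ.app (x⟦n⟧)) from
    isIso_app_of_iso τ ((shiftFunctorZero C ℤ).app x) (h 0)
  refine hC.induction (fun x => ∀ n : ℤ, IsIso (τ.app (x⟦n⟧))) ?_ ?_ ?_ ?_ x
  · exact fun e h n => isIso_app_of_iso τ ((shiftFunctor C n).mapIso e) (h n)
  · exact fun x hx n => hτ _ (hx.shift n)
  · intro J X hX n
    have := hF J
    have := hG J
    exact isIso_app_of_isColimit (Functor.whiskerLeft (shiftFunctor C n) τ)
      (colimit.isColimit (Discrete.functor X)) fun j => hX j.as n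
  · intro T hT h₁ h₂ n
    have hT' := Triangle.shift_distinguished T hT n
    rw [hD.isIso_iff_isIso_map]
    intro d _
    have hd (y : C) (h : IsIso (τ.app y)) :
        IsIso ((Functor.whiskerRight τ (preadditiveCoyoneda.obj (op d))).app y) := by
      dsimp; infer_instance
    refine isIso_app_obj₃_of_isHomological
      (Functor.whiskerRight τ (preadditiveCoyoneda.obj (op d))) hT' ?_ ?_ ?_ ?_
    · exact hd _ (h₁ n)
    · exact hd _ (h₂ n)
    · exact hd _
        (isIso_app_of_iso τ ((shiftFunctorAdd C n 1).app T.obj₁) (h₁ (n + 1)))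
    · exact hd _
        (isIso_app_of_iso τ ((shiftFunctorAdd C n 1).app T.obj₂) (h₂ (n + 1)))

end ExactTransformation

open Functor.LaxMonoidal Functor.OplaxMonoidal

/-! ### Rigid objects and exact pairings -/

section Rigid

variable {C : Type u} [Category.{v} C] [MonoidalCategory C]

section Closed

variable [MonoidalClosed C]

lemma uncurry_comp_dualTensorToHom {t y z : C} (h : z ⟶ (ihom t).obj (𝟙_ C) ⊗ y) :
    MonoidalClosed.uncurry (h ≫ dualTensorToHom t y) =
      t ◁ h ≫ (α_ _ _ _).inv ≫ ((ihom.ev t).app (𝟙_ C) ▷ y) ≫ (λ_ y).hom := by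
  rw [MonoidalClosed.uncurry_natural_left, dualTensorToHom, MonoidalClosed.uncurry_curry]

/-- A rigid object is right dual to its internal dual. -/
@[reducible]
noncomputable def exactPairingOfIsRigidObj {t : C} (ht : IsRigidObj t) :
    ExactPairing ((ihom t).obj (𝟙_ C)) t :=
  have := ht t
  -- The first triangle identity is the uncurried form of the equation defining the coevaluation.
  have h₁ : t ◁ (MonoidalClosed.curry (ρ_ t).hom ≫ inv (dualTensorToHom t t)) ≫ (α_ _ _ _).inv ≫
      ((ihom.ev t).app (𝟙_ C)) ▷ t = (ρ_ t).hom ≫ (λ_ t).inv := by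
    rw [Iso.eq_comp_inv]
    have := uncurry_comp_dualTensorToHom
      (MonoidalClosed.curry (ρ_ t).hom ≫ inv (dualTensorToHom t t))
    rw [assoc, IsIso.inv_hom_id, comp_id, MonoidalClosed.uncurry_curry] at this
    simpa using this.symm
  { coevaluation' := MonoidalClosed.curry (ρ_ t).hom ≫ inv (dualTensorToHom t t)
    evaluation' := (ihom.ev t).app (𝟙_ C)
    coevaluation_evaluation' := h₁
    evaluation_coevaluation' := by
      -- The second identity may be checked after composing with the isomorphism `dualTensorToHom t
      -- (𝟙_ C)` and uncurrying; exchanging the two evaluations then reduces it to the first.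
      have := ht (𝟙_ C)
      generalize MonoidalClosed.curry (ρ_ t).hom ≫ inv (dualTensorToHom t t) = c at h₁ ⊢
      rw [← cancel_mono (dualTensorToHom t (𝟙_ C))]
      apply MonoidalClosed.uncurry_injective
      rw [uncurry_comp_dualTensorToHom, uncurry_comp_dualTensorToHom]
      generalize (ihom.ev t).app (𝟙_ C) = e at h₁ ⊢
      change t ⊗ (ihom t).obj (𝟙_ C) ⟶ 𝟙_ C at e
      have h₂ : t ◁ c ⊗≫ e ▷ t = ⊗𝟙.hom := by
        convert! h₁ using 1 <;> simp [monoidalComp]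
      calc
        _ = 𝟙 _ ⊗≫ t ◁ c ▷ ((ihom t).obj (𝟙_ C)) ⊗≫
            ((t ⊗ (ihom t).obj (𝟙_ C)) ◁ e ≫ e ▷ 𝟙_ C) ⊗≫ 𝟙 _ := by
          monoidal
        _ = 𝟙 _ ⊗≫ (t ◁ c ⊗≫ e ▷ t) ▷ ((ihom t).obj (𝟙_ C)) ⊗≫ e ⊗≫ 𝟙 _ := by
          rw [whisker_exchange]; monoidal
        _ = _ := by
          rw [h₂]; monoidal }

variable (C) in
-- Tensoring with 𝟙 is an equivalence, so its right adjoint hom(𝟙, -) is one too, and unit and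
-- counit are invertible.
lemma isRigidObj_unit : IsRigidObj (𝟙_ C) := fun y => by
  have : (tensorLeft (𝟙_ C)).IsEquivalence := Functor.isEquivalence_of_iso (leftUnitorNatIso C).symm
  have : (ihom (𝟙_ C)).IsEquivalence :=
    (ihom.adjunction (𝟙_ C)).isEquivalence_right_of_isEquivalence_left
  have h₁ : IsIso ((ihom.ev (𝟙_ C)).app (𝟙_ C)) :=
    inferInstanceAs (IsIso ((ihom.adjunction (𝟙_ C)).counit.app (𝟙_ C)))
  have h₂ (z : C) : IsIso ((ihom.coev (𝟙_ C)).app z) :=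
    inferInstanceAs (IsIso ((ihom.adjunction (𝟙_ C)).unit.app z))
  rw [dualTensorToHom, MonoidalClosed.curry_eq]
  have := h₂ ((ihom (𝟙_ C)).obj (𝟙_ C) ⊗ y)
  infer_instance

end Closed

/-- An object `b` with a pairing `b ⊗ r ⟶ 𝟙` representing `Hom(- ⊗ r, 𝟙)` is dual to any `r` having
a dual. -/
lemma bijective_of_perfect_pairing {r r' b : C} [ExactPairing r r'] (e : b ⊗ r ⟶ 𝟙_ C)
    (he : ∀ z : C, Function.Bijective (fun g : z ⟶ b => g ▷ r ≫ e)) (y : C) :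
    Function.Bijective (fun ψ : 𝟙_ C ⟶ r ⊗ y =>
      (ρ_ b).inv ≫ b ◁ ψ ≫ (α_ _ _ _).inv ≫ e ▷ y ≫ (λ_ y).hom) := by
  have hev (z : C) : Function.Bijective (fun g : z ⟶ r' => g ▷ r ≫ ε_ r r') := by
    let E : (z ⟶ r') ≃ (z ⊗ r ⟶ 𝟙_ C) :=
      (Iso.homCongr (Iso.refl z) (λ_ r').symm).trans (tensorRightHomEquiv z r r' (𝟙_ C)).symm
    convert! E.bijective using 2 with g
    simp [E, tensorRightHomEquiv]
    rw [← unitors_equal, Iso.inv_hom_id, comp_id]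
  obtain ⟨i, hi⟩ := (hev b).2 e
  dsimp at hi
  -- `b` and `r'` both represent Hom(- ⊗ r, 𝟙), and `i` is the comparison map.
  have : IsIso i := by
    refine isIso_of_yoneda_map_bijective i fun z => ?_
    refine (Function.Bijective.of_comp_iff' (hev z) _).1 ?_
    convert! he z using 2 with g
    simp [← hi]
  let E : (𝟙_ C ⟶ r ⊗ y) ≃ (b ⟶ y) :=
    (tensorLeftHomEquiv (𝟙_ C) r r' y).symm.trans
      (Iso.homCongr ((ρ_ r') ≪≫ (asIso i).symm) (Iso.refl y))
  convert! E.bijective using 2 with ψ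
  simp only [← hi, comp_whiskerRight, assoc, tensorLeftHomEquiv, Equiv.coe_trans,
    Function.comp_apply,
    Equiv.coe_fn_symm_mk, Iso.homCongr_apply, Iso.trans_inv, Iso.symm_inv, asIso_hom, Iso.refl_hom,
    comp_id, E]
  rw [← associator_inv_naturality_left_assoc, whisker_exchange_assoc,
    ← rightUnitor_inv_naturality_assoc]

end Rigid

section MapPairing

variable {C : Type u₁} [Category.{v} C] [MonoidalCategory C]
  {D : Type u₂} [Category.{v} D] [MonoidalCategory D]

/-- A monoidal functor preserves exact pairings. -/
@[reducible]
noncomputable def exactPairingMap (F : D ⥤ C) [F.Monoidal] (X Y : D) [ExactPairing X Y] :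
    ExactPairing (F.obj X) (F.obj Y) where
  coevaluation' := ε F ≫ F.map (η_ X Y) ≫ δ F X Y
  evaluation' := μ F Y X ≫ F.map (ε_ X Y) ≫ η F
  coevaluation_evaluation' := by
    have h : μ F Y (𝟙_ D) ≫ F.map (Y ◁ η_ X Y ≫ (α_ _ _ _).inv ≫ ε_ X _ ▷ Y) ≫ δ F (𝟙_ D) Y =
      μ F Y (𝟙_ D) ≫ F.map ((ρ_ Y).hom ≫ (λ_ Y).inv) ≫ δ F (𝟙_ D) Y := by
        rw [ExactPairing.coevaluation_evaluation]
    simp only [Functor.map_comp, Functor.Monoidal.map_whiskerLeft,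
      Functor.Monoidal.map_whiskerRight, Functor.Monoidal.map_associator_inv, assoc,
      Functor.Monoidal.μ_δ_assoc, Functor.Monoidal.μ_δ, comp_id] at h
    simp [reassoc_of% h]
  evaluation_coevaluation' := by
    have h : μ F (𝟙_ D) X ≫ F.map (η_ X Y ▷ X ≫ (α_ _ _ _).hom ≫ X ◁ ε_ X Y) ≫ δ F X (𝟙_ D) =
      μ F (𝟙_ D) X ≫ F.map ((λ_ X).hom ≫ (ρ_ X).inv) ≫ δ F X (𝟙_ D) := by
        rw [ExactPairing.evaluation_coevaluation]
    simp only [Functor.map_comp, Functor.Monoidal.map_whiskerLeft,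
      Functor.Monoidal.map_whiskerRight, Functor.Monoidal.map_associator, assoc,
      Functor.Monoidal.μ_δ_assoc, Functor.Monoidal.μ_δ, comp_id] at h
    simp [reassoc_of% h]

end MapPairing

open Functor.LaxMonoidal Functor.OplaxMonoidal

/-! ### The projection formula and trace duality -/

section Projection

variable {C : Type u₁} [Category.{v} C] [MonoidalCategory C]
  {D : Type u₂} [Category.{v} D] [MonoidalCategory D] {F : D ⥤ C} [F.Monoidal] {R : C ⥤ D}
  (adj : F ⊣ R)

/-- The projection morphism `R x ⊗ y ⟶ R (x ⊗ F y)`. -/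
def projMap (x : C) (y : D) : R.obj x ⊗ y ⟶ R.obj (x ⊗ F.obj y) :=
  adj.homEquiv _ _ (δ F (R.obj x) y ≫ adj.counit.app x ▷ F.obj y)

/-- The projection morphism with the other order of the factors. -/
def projMapLeft (y : D) (x : C) : y ⊗ R.obj x ⟶ R.obj (F.obj y ⊗ x) :=
  adj.homEquiv _ _ (δ F y (R.obj x) ≫ F.obj y ◁ adj.counit.app x)

lemma projMap_natural_left {x x' : C} (f : x ⟶ x') (y : D) :
    R.map f ▷ y ≫ projMap adj x' y = projMap adj x y ≫ R.map (f ▷ F.obj y) := by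
  rw [projMap, projMap, ← adj.homEquiv_naturality_left, ← adj.homEquiv_naturality_right]
  congr 1
  rw [← δ_natural_left_assoc, assoc, ← comp_whiskerRight, ← comp_whiskerRight]
  simp

lemma projMap_natural_right (x : C) {y y' : D} (f : y ⟶ y') :
    R.obj x ◁ f ≫ projMap adj x y' = projMap adj x y ≫ R.map (x ◁ F.map f) := by
  rw [projMap, projMap, ← adj.homEquiv_naturality_left, ← adj.homEquiv_naturality_right]
  congr 1
  rw [← δ_natural_right_assoc, assoc, whisker_exchange]
  rfl

/-- The projection morphism, as a transformation in the second variable. -/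
@[simps]
def projTrans (x : C) : tensorLeft (R.obj x) ⟶ F ⋙ tensorLeft x ⋙ R where
  app y := projMap adj x y
  naturality _ _ f := projMap_natural_right adj x f

/-- The projection morphism is an isomorphism for objects admitting a dual. -/
lemma isIso_projMap_of_exactPairing (x : C) (y' y : D) [ExactPairing y' y] :
    IsIso (projMap adj x y) := by
  let := exactPairingMap F y' y
  refine isIso_of_yoneda_map_bijective _ fun d => ?_
  -- Hom(d, R x ⊗ y) ≅ Hom(d ⊗ y', R x) ≅ Hom(F d ⊗ F y', x) ≅ Hom(F d, x ⊗ F y).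
  let E : (d ⟶ R.obj x ⊗ y) ≃ (d ⟶ R.obj (x ⊗ F.obj y)) :=
    (tensorRightHomEquiv d y' y (R.obj x)).symm.trans <|
      (adj.homEquiv _ _).symm.trans <|
      (Iso.homCongr (Functor.Monoidal.μIso F d y').symm (Iso.refl x)).trans <|
      (tensorRightHomEquiv (F.obj d) (F.obj y') (F.obj y) x).trans (adj.homEquiv _ _)
  convert! E.bijective using 2 with f
  rw [← (adj.homEquiv _ _).symm.injective.eq_iff,
    ← (tensorRightHomEquiv (F.obj d) (F.obj y') (F.obj y) x).symm.injective.eq_iff]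
  simp only [E, Equiv.trans_apply, Equiv.symm_apply_apply]
  rw [Adjunction.homEquiv_naturality_left_symm]
  simp only [projMap, Equiv.symm_apply_apply, tensorRightHomEquiv, Equiv.coe_fn_symm_mk]
  have hev : ε_ (F.obj y') (F.obj y) = μ F y y' ≫ F.map (ε_ y' y) ≫ η F := rfl
  rw [hev]
  simp only [Adjunction.homEquiv_counit, comp_whiskerRight, assoc, Iso.homCongr_apply,
    Iso.symm_inv, Functor.Monoidal.μIso_hom, Iso.refl_hom, comp_id, Functor.map_comp,
    MonoidalCategory.whiskerLeft_comp, Functor.Monoidal.map_whiskerRight,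
    Functor.Monoidal.map_whiskerLeft, Functor.Monoidal.map_associator,
    Functor.Monoidal.map_rightUnitor, Functor.Monoidal.μ_δ_assoc]
  have hc := rightUnitor_naturality (adj.counit.app x)
  have ha := associator_naturality_left (adj.counit.app x) (F.obj y) (F.obj y')
  dsimp at hc ha
  rw [← hc, whisker_exchange_assoc, whisker_exchange_assoc, whisker_exchange_assoc,
    reassoc_of% ha]

lemma projMapLeft_eq [SymmetricCategory C] [BraidedCategory D] (F : D ⥤ C) [F.Braided] {R : C ⥤ D}
    (adj : F ⊣ R) (y : D) (x : C) :
    projMapLeft adj y x = (β_ y (R.obj x)).hom ≫ projMap adj x y ≫ R.map (β_ _ _).hom := by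
  rw [projMapLeft, projMap, ← adj.homEquiv_naturality_right, ← adj.homEquiv_naturality_left]
  congr 1
  simp

variable [R.LaxMonoidal] [adj.IsMonoidal]

lemma projMap_eq (x : C) (y : D) : projMap adj x y = R.obj x ◁ adj.unit.app y ≫ μ R _ _ := by
  apply (adj.homEquiv _ _).symm.injective
  have h₁ : F.map (R.obj x ◁ adj.unit.app y) ≫ δ F _ _ =
      δ F _ _ ≫ F.obj (R.obj x) ◁ F.map (adj.unit.app y) := (δ_natural_right F _ _).symm
  have h₂ : F.obj (R.obj x) ◁ F.map (adj.unit.app y) ≫ F.obj (R.obj x) ◁ adj.counit.app (F.obj y) =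
      𝟙 (F.obj (R.obj x) ⊗ F.obj y) := by
    rw [← MonoidalCategory.whiskerLeft_comp]; simp
  rw [projMap, Equiv.symm_apply_apply, adj.homEquiv_counit, F.map_comp, assoc,
    adj.map_μ_comp_counit_app_tensor, tensorHom_def']
  exact ((reassoc_of% h₁) _).trans (congrArg (δ F (R.obj x) y ≫ ·) ((reassoc_of% h₂) _)) |>.symm

lemma projMapLeft_eq_unit_comp_μ (x : C) (y : D) :
    projMapLeft adj y x = adj.unit.app y ▷ R.obj x ≫ μ R _ _ := by
  apply (adj.homEquiv _ _).symm.injective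
  have h₁ : F.map (adj.unit.app y ▷ R.obj x) ≫ δ F _ _ =
      δ F _ _ ≫ F.map (adj.unit.app y) ▷ F.obj (R.obj x) := (δ_natural_left F _ _).symm
  have h₂ : F.map (adj.unit.app y) ▷ F.obj (R.obj x) ≫ adj.counit.app (F.obj y) ▷ F.obj (R.obj x) =
      𝟙 (F.obj y ⊗ F.obj (R.obj x)) := by
    rw [← comp_whiskerRight]; simp
  rw [projMapLeft, Equiv.symm_apply_apply, adj.homEquiv_counit, F.map_comp, assoc,
    adj.map_μ_comp_counit_app_tensor, MonoidalCategory.tensorHom_def]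
  exact ((reassoc_of% h₁) _).trans (congrArg (δ F y (R.obj x) ≫ ·) ((reassoc_of% h₂) _)) |>.symm

/-- Associativity of the lax structure on `R`, once the projection morphism is written as the unit
followed by `μ`. -/
lemma whiskerLeft_projMap_comp_μ (s a : C) (y : D) :
    (α_ _ _ _).inv ≫ μ R s a ▷ y ≫ projMap adj (s ⊗ a) y =
      R.obj s ◁ projMap adj a y ≫ μ R s (a ⊗ F.obj y) ≫ R.map (α_ _ _ _).inv := by
  rw [projMap_eq, projMap_eq]
  generalize adj.unit.app y = u
  change y ⟶ R.obj (F.obj y) at u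
  rw [← whisker_exchange_assoc, ← associator_inv_naturality_right_assoc,
    MonoidalCategory.whiskerLeft_comp, assoc, Functor.LaxMonoidal.associativity_inv]
  rfl

/-- The pairing `R (w ⊗ x) ⊗ R a ⟶ 𝟙` given by a duality between `a` and `x` and a trace
`R w ⟶ 𝟙`. -/
def tracePairing {w : C} (t : R.obj w ⟶ 𝟙_ D) (a x : C) [ExactPairing a x] :
    R.obj (w ⊗ x) ⊗ R.obj a ⟶ 𝟙_ D :=
  μ R _ _ ≫ R.map ((α_ w x a).hom ≫ w ◁ ε_ a x ≫ (ρ_ w).hom) ≫ t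

/-- The trace pairing is perfect if the projection morphisms are isomorphisms and the trace is
universal. -/
lemma bijective_whiskerRight_tracePairing (h : ∀ x y, IsIso (projMapLeft adj y x)) {w : C}
    (t : R.obj w ⟶ 𝟙_ D)
    (ht : ∀ z : C, Function.Bijective (fun g : z ⟶ w => R.map g ≫ t)) (a x : C) [ExactPairing a x]
    (z : D) :
    Function.Bijective (fun g : z ⟶ R.obj (w ⊗ x) => g ▷ R.obj a ≫ tracePairing t a x) := by
  have := h a z
  -- Hom(z, R(w ⊗ x)) ≅ Hom(F z ⊗ a, w) ≅ Hom(R(F z ⊗ a), 𝟙) ≅ Hom(z ⊗ R a, 𝟙).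
  let E : (z ⟶ R.obj (w ⊗ x)) ≃ (z ⊗ R.obj a ⟶ 𝟙_ D) :=
    (adj.homEquiv _ _).symm.trans <|
      (tensorRightHomEquiv (F.obj z) a x w).symm.trans <|
      (Equiv.ofBijective _ (ht _)).trans
      (Iso.homCongr (asIso (projMapLeft adj z a)).symm (Iso.refl _))
  convert! E.bijective using 2 with g
  obtain ⟨g, rfl⟩ := (adj.homEquiv _ _).surjective g
  simp only [E, Equiv.trans_apply, Equiv.symm_apply_apply]
  simp only [tracePairing, tensorRightHomEquiv, Equiv.coe_fn_symm_mk, Equiv.ofBijective_apply,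
    Iso.homCongr_apply, Iso.symm_inv, asIso_hom, Iso.refl_hom, comp_id,
    projMapLeft_eq_unit_comp_μ, assoc, adj.homEquiv_unit]
  generalize adj.unit.app z = u
  change z ⟶ R.obj (F.obj z) at u
  simp only [Functor.map_comp, comp_whiskerRight, assoc, μ_natural_left_assoc]

/-- The transpose `x ⟶ F y` of a map `𝟙 ⟶ R a ⊗ y` under a duality between `a` and `x`. -/
noncomputable def projTranspose (h : ∀ x y, IsIso (projMap adj x y)) (a x : C) [ExactPairing a x]
    (y : D) : (𝟙_ D ⟶ R.obj a ⊗ y) ≃ (x ⟶ F.obj y) :=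
  have := h a y
  (Iso.homCongr (Iso.refl _) (asIso (projMap adj a y))).trans <|
    (adj.homEquiv _ _).symm.trans <|
    (Iso.homCongr (Functor.Monoidal.εIso F).symm (Iso.refl _)).trans <|
    (tensorLeftHomEquiv (𝟙_ C) a x (F.obj y)).symm.trans
    (Iso.homCongr (ρ_ x) (Iso.refl _))

/-- Duality for the trace: maps `x ⟶ F y` correspond to maps `R (w ⊗ x) ⟶ y`. -/
theorem bijective_map_whiskerLeft_comp_trace (h : ∀ x y, IsIso (projMap adj x y))
    (h' : ∀ x y, IsIso (projMapLeft adj y x)) {w : C}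
    (t : R.obj w ⟶ 𝟙_ D)
    (ht : ∀ z : C, Function.Bijective (fun g : z ⟶ w => R.map g ≫ t)) (a x : C) [ExactPairing a x]
    {r : D} [ExactPairing (R.obj a) r] (y : D) :
    Function.Bijective (fun φ : x ⟶ F.obj y =>
      R.map (w ◁ φ) ≫ inv (projMap adj w y) ≫ t ▷ y ≫ (λ_ y).hom) := by
  -- Perfectness of the trace pairing identifies R(w ⊗ x) with the dual of R a. The rest checks that
  -- the resulting bijection, transported along `projTranspose`, is the stated formula.
  have hb := bijective_of_perfect_pairing (r' := r) (tracePairing t a x)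
    (bijective_whiskerRight_tracePairing adj h' t ht a x) y
  refine (Function.Bijective.of_comp_iff _ (projTranspose adj h a x y).bijective).1 ?_
  convert! hb using 2 with ψ
  have := h a y
  have := h w y
  obtain ⟨ψ', hψ'⟩ := (adj.homEquiv (𝟙_ D) (a ⊗ F.obj y)).surjective (ψ ≫ projMap adj a y)
  have hφ : projTranspose adj h a x y ψ =
      (ρ_ x).inv ≫ x ◁ (ε F ≫ ψ') ≫ (α_ _ _ _).inv ≫ ε_ a x ▷ _ ≫ (λ_ _).hom := by
    simp [projTranspose, ← hψ', tensorLeftHomEquiv]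
  have hψ : ψ ≫ projMap adj a y = ε R ≫ R.map (ε F ≫ ψ') := by
    rw [← hψ', ← adj.unit_app_unit_comp_map_η, adj.homEquiv_unit, assoc, ← R.map_comp,
      Functor.Monoidal.η_ε_assoc]
  rw [Function.comp_apply, hφ]
  obtain ⟨p, hp⟩ : ∃ p, p = (α_ w x a).hom ≫ w ◁ ε_ a x ≫ (ρ_ w).hom := ⟨_, rfl⟩
  have key : R.obj (w ⊗ x) ◁ ψ ≫ (α_ _ _ _).inv ≫ μ R _ _ ▷ y ≫ R.map p ▷ y ≫ projMap adj w y =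
      (ρ_ _).hom ≫ R.map (w ◁ ((ρ_ x).inv ≫ x ◁ (ε F ≫ ψ') ≫ (α_ _ _ _).inv ≫
        ε_ a x ▷ _ ≫ (λ_ _).hom)) := by
    rw [projMap_natural_left]
    have h₁ := whiskerLeft_projMap_comp_μ adj (w ⊗ x) a y
    rw [reassoc_of% h₁, ← MonoidalCategory.whiskerLeft_comp_assoc, hψ]
    generalize ε F ≫ ψ' = χ
    rw [MonoidalCategory.whiskerLeft_comp, assoc, μ_natural_right_assoc,
      Functor.LaxMonoidal.right_unitality]
    simp only [assoc, ← R.map_comp]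
    congr 3
    rw [hp]
    monoidal
  rw [← cancel_epi (ρ_ _).hom, ← reassoc_of% key]
  simp [tracePairing, hp, -Functor.LaxMonoidal.right_unitality]

end Projection

section Preserves

variable {A : Type*} [Category.{v} A] {B : Type*} [Category.{v} B] {E : Type*} [Category.{v} E]

lemma PreservesAllCoproducts.comp {F : A ⥤ B} {G : B ⥤ E} (hF : PreservesAllCoproducts F)
    (hG : PreservesAllCoproducts G) : PreservesAllCoproducts (F ⋙ G) := fun J => by
  have := hF J
  have := hG J
  infer_instance

end Preserves

section TensorTriangulatedBasics

variable {C : Type u} [Category.{v} C] [Preadditive C] [MonoidalCategory C] [MonoidalClosed C]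

lemma IsRigidlyCompactlyGenerated.isCompactObj_unit (hC : IsRigidlyCompactlyGenerated C) :
    IsCompactObj (𝟙_ C) :=
  (hC.compact_iff_rigid _).2 (isRigidObj_unit C)

variable [HasZeroObject C] [HasBinaryBiproducts C]

lemma isCompactObj_tensor_of_exactPairing (y x : C) [ExactPairing y x] {z : C}
    (hz : IsCompactObj z) : IsCompactObj (x ⊗ z) :=
  PreservesCompacts.of_adjunction (tensorLeftAdjunction y x)
    (.of_isLeftAdjoint (tensorLeft y)) z hz

lemma IsRigidlyCompactlyGenerated.isCompactObj_of_exactPairing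
    (hC : IsRigidlyCompactlyGenerated C) (y x : C) [ExactPairing y x] : IsCompactObj x :=
  (isCompactObj_tensor_of_exactPairing y x hC.isCompactObj_unit).of_iso (ρ_ x).symm

variable [BraidedCategory C]

/-- A compact object has a compact dual. -/
lemma IsRigidlyCompactlyGenerated.exists_exactPairing (hC : IsRigidlyCompactlyGenerated C) {x : C}
    (hx : IsCompactObj x) :
    ∃ a : C, Nonempty (ExactPairing a x) ∧ Nonempty (ExactPairing x a) ∧ IsCompactObj a := by
  let e := exactPairingOfIsRigidObj ((hC.compact_iff_rigid x).1 hx)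
  let e' := BraidedCategory.exactPairing_swap ((ihom x).obj (𝟙_ C)) x
  exact ⟨_, ⟨e⟩, ⟨e'⟩, hC.isCompactObj_of_exactPairing x _⟩

end TensorTriangulatedBasics

/-! ### The isomorphism F ≅ hom(U 𝟙, U -) -/

section Duality

variable {C : Type u₁} [Category.{v} C] [Preadditive C] [HasZeroObject C] [HasShift C ℤ]
  [∀ n : ℤ, (shiftFunctor C n).Additive] [Pretriangulated C]
  [MonoidalCategory C] [SymmetricCategory C] [MonoidalClosed C] [TensorTriangulated C]
  {D : Type u₂} [Category.{v} D] [Preadditive D] [HasZeroObject D] [HasShift D ℤ]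
  [∀ n : ℤ, (shiftFunctor D n).Additive] [Pretriangulated D]
  [MonoidalCategory D] [SymmetricCategory D] [MonoidalClosed D] [TensorTriangulated D]
  {F : D ⥤ C} [F.Braided] [F.CommShift ℤ] [F.IsTriangulated] {R : C ⥤ D} {U : D ⥤ C}

/-- The projection formula. -/
theorem isIso_projMap (hD : IsRigidlyCompactlyGenerated D) (adj₂ : F ⊣ R) (adj₃ : R ⊣ U)
    (x : C) (y : D) : IsIso (projMap adj₂ x y) := by
  let := adj₂.rightAdjointCommShift ℤ
  have := adj₂.commShift_of_leftAdjoint ℤ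
  have := adj₂.isTriangulated_rightAdjoint
  have := adj₂.isLeftAdjoint
  have := adj₃.isLeftAdjoint
  -- Both sides are exact and preserve coproducts in `y`, so compact `y` suffice, and those have
  -- duals.
  refine hD.isCompactlyGenerated.isIso_app hD.isCompactlyGenerated
    (.of_isLeftAdjoint (tensorLeft (R.obj x))) (G := F ⋙ tensorLeft x ⋙ R)
    (.comp (.of_isLeftAdjoint F) (.comp (.of_isLeftAdjoint (tensorLeft x)) (.of_isLeftAdjoint R)))
    (projTrans adj₂ x) (fun y hy => ?_) y
  obtain ⟨y', ⟨_⟩, -, -⟩ := hD.exists_exactPairing hy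
  exact isIso_projMap_of_exactPairing adj₂ x y' y

theorem isIso_projMapLeft (hD : IsRigidlyCompactlyGenerated D) (adj₂ : F ⊣ R) (adj₃ : R ⊣ U)
    (x : C) (y : D) : IsIso (projMapLeft adj₂ y x) := by
  have := isIso_projMap hD adj₂ adj₃ x y
  rw [projMapLeft_eq]
  infer_instance

/-- The canonical map `F y ⟶ hom(U 𝟙, U y)`. -/
noncomputable def toIhomDualizing (hD : IsRigidlyCompactlyGenerated D) (adj₂ : F ⊣ R)
    (adj₃ : R ⊣ U) : F ⟶ U ⋙ ihom (U.obj (𝟙_ D)) where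
  app y :=
    have := isIso_projMap hD adj₂ adj₃ (U.obj (𝟙_ D)) y
    MonoidalClosed.curry (adj₃.homEquiv _ _
      (inv (projMap adj₂ (U.obj (𝟙_ D)) y) ≫ adj₃.counit.app (𝟙_ D) ▷ y ≫ (λ_ y).hom))
  naturality y y' f := by
    have := isIso_projMap hD adj₂ adj₃ (U.obj (𝟙_ D)) y
    have := isIso_projMap hD adj₂ adj₃ (U.obj (𝟙_ D)) y'
    dsimp
    rw [← MonoidalClosed.curry_natural_left, ← MonoidalClosed.curry_natural_right,
      ← adj₃.homEquiv_naturality_left, ← adj₃.homEquiv_naturality_right]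
    congr 2
    have h : R.map (U.obj (𝟙_ D) ◁ F.map f) ≫ inv (projMap adj₂ (U.obj (𝟙_ D)) y') =
        inv (projMap adj₂ (U.obj (𝟙_ D)) y) ≫ R.obj (U.obj (𝟙_ D)) ◁ f := by
      rw [IsIso.eq_inv_comp, ← assoc, ← projMap_natural_right, assoc, IsIso.hom_inv_id, comp_id]
    rw [reassoc_of% h]
    have h' := whisker_exchange_assoc (adj₃.counit.app (𝟙_ D)) f (λ_ y').hom
    dsimp at h'
    rw [h']
    simp

/-- `hU` enters only to make R a compact for the dual a of a compact x; R a then has a dual, and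
trace duality gives the bijection on maps out of x. -/
theorem isIso_toIhomDualizing (hC : IsRigidlyCompactlyGenerated C)
    (hD : IsRigidlyCompactlyGenerated D) (adj₂ : F ⊣ R) (adj₃ : R ⊣ U)
    (hU : PreservesAllCoproducts U) (y : D) :
    IsIso ((toIhomDualizing hD adj₂ adj₃).app y) := by
  refine hC.isCompactlyGenerated.isIso_of_bijective_comp _ fun x hx => ?_
  let := adj₂.rightAdjointLaxMonoidal
  obtain ⟨a, ⟨_⟩, -, ha⟩ := hC.exists_exactPairing hx
  have hRa : IsCompactObj (R.obj a) := PreservesCompacts.of_adjunction adj₃ hU a ha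
  obtain ⟨r, -, ⟨_⟩, -⟩ := hD.exists_exactPairing hRa
  have h := bijective_map_whiskerLeft_comp_trace adj₂ (isIso_projMap hD adj₂ adj₃)
    (isIso_projMapLeft hD adj₂ adj₃) (adj₃.counit.app (𝟙_ D))
    (fun z => by
      convert! (adj₃.homEquiv z (𝟙_ D)).symm.bijective using 2 with g) a x (r := r) y
  let E : (R.obj (U.obj (𝟙_ D) ⊗ x) ⟶ y) ≃ (x ⟶ (ihom (U.obj (𝟙_ D))).obj (U.obj y)) :=
    (adj₃.homEquiv _ _).trans ((ihom.adjunction (U.obj (𝟙_ D))).homEquiv _ _)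
  convert! E.bijective.comp h using 2 with φ
  have := isIso_projMap hD adj₂ adj₃ (U.obj (𝟙_ D)) y
  simp only [toIhomDualizing, E, Function.comp_apply, Equiv.trans_apply]
  rw [adj₃.homEquiv_naturality_left, MonoidalClosed.homEquiv_apply_eq,
    MonoidalClosed.curry_natural_left]

/-- The isomorphism `F ≅ hom(U 𝟙, U -)`. -/
noncomputable def isoIhomDualizing (hC : IsRigidlyCompactlyGenerated C)
    (hD : IsRigidlyCompactlyGenerated D) (adj₂ : F ⊣ R) (adj₃ : R ⊣ U)
    (hU : PreservesAllCoproducts U) :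
    F ≅ U ⋙ ihom (U.obj (𝟙_ D)) :=
  have := isIso_toIhomDualizing hC hD adj₂ adj₃ hU
  have := NatIso.isIso_of_isIso_app (toIhomDualizing hD adj₂ adj₃)
  asIso (toIhomDualizing hD adj₂ adj₃)

end Duality

/-! ### The map hom(z, 𝟙) ⊗ w ⟶ hom(z, w) for arbitrary z -/

section DualTensor

variable {C : Type u} [Category.{v} C] [MonoidalCategory C] [MonoidalClosed C]

lemma dualTensorToHom_natural {z z' : C} (f : z ⟶ z') (w : C) :
    (MonoidalClosed.pre f).app (𝟙_ C) ▷ w ≫ dualTensorToHom z w =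
      dualTensorToHom z' w ≫ (MonoidalClosed.pre f).app w := by
  apply MonoidalClosed.uncurry_injective
  rw [uncurry_comp_dualTensorToHom, MonoidalClosed.uncurry_pre_app, dualTensorToHom,
    MonoidalClosed.uncurry_curry, associator_inv_naturality_middle_assoc,
    ← comp_whiskerRight_assoc, MonoidalClosed.id_tensor_pre_app_comp_ev]
  simp

/-- The maps `hom(z, 𝟙) ⊗ w ⟶ hom(z, w)`, as a transformation in `z`. -/
@[simps]
noncomputable def dualTensorToHomTrans (w : C) :
    MonoidalClosed.internalHom.flip.obj (𝟙_ C) ⋙ tensorRight w ⟶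
      MonoidalClosed.internalHom.flip.obj w where
  app z := dualTensorToHom z.unop w
  naturality _ _ f := dualTensorToHom_natural f.unop w

end DualTensor

section Contravariant

variable {C : Type u} [Category.{v} C] [Preadditive C] [HasZeroObject C] [HasShift C ℤ]
  [∀ n : ℤ, (shiftFunctor C n).Additive] [Pretriangulated C]

/-- The five lemma for a transformation of contravariant homological functors. -/
lemma isIso_app_op_obj₃ {H K : Cᵒᵖ ⥤ AddCommGrpCat.{v}}
    (hH : ∀ {T : Triangle C}, T ∈ distTriang C →
      Function.Exact (H.map T.mor₂.op).hom (H.map T.mor₁.op).hom)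
    (hK : ∀ {T : Triangle C}, T ∈ distTriang C →
      Function.Exact (K.map T.mor₂.op).hom (K.map T.mor₁.op).hom)
    (τ : H ⟶ K) {T : Triangle C} (hT : T ∈ distTriang C)
    (h₁ : IsIso (τ.app (op T.obj₁))) (h₂ : IsIso (τ.app (op T.obj₂)))
    (h₁' : IsIso (τ.app (op (T.obj₁⟦(1 : ℤ)⟧)))) (h₂' : IsIso (τ.app (op (T.obj₂⟦(1 : ℤ)⟧)))) :
    IsIso (τ.app (op T.obj₃)) := by
  have hT' := rot_of_distTriang _ hT
  have hT'' := rot_of_distTriang _ hT'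
  have hc {x y : Cᵒᵖ} (f : x ⟶ y) : (K.map f).hom.comp (τ.app x).hom =
      (τ.app y).hom.comp (H.map f).hom := by
    rw [← AddCommGrpCat.hom_comp, ← AddCommGrpCat.hom_comp, τ.naturality]
  rw [isIso_iff_bijective_hom] at *
  exact AddMonoidHom.bijective_of_surjective_of_bijective_of_bijective_of_injective
    (H.map T.rotate.rotate.mor₂.op).hom (H.map T.mor₃.op).hom (H.map T.mor₂.op).hom
    (H.map T.mor₁.op).hom
    (K.map T.rotate.rotate.mor₂.op).hom (K.map T.mor₃.op).hom (K.map T.mor₂.op).hom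
    (K.map T.mor₁.op).hom
    (τ.app _).hom (τ.app _).hom (τ.app _).hom (τ.app _).hom (τ.app _).hom
    (hc _) (hc _) (hc _) (hc _) (hH hT'') (hH hT') (hH hT) (hK hT'') (hK hT') (hK hT)
    h₂'.2 h₁' h₂ h₁.1

variable [MonoidalCategory C] [SymmetricCategory C] [MonoidalClosed C] [TensorTriangulated C]

lemma isHomological_tensorRight_comp (w : C) (Q : C ⥤ AddCommGrpCat.{v}) [Q.IsHomological] :
    (tensorRight w ⋙ Q).IsHomological :=
  .of_iso (Functor.isoWhiskerRight (BraidedCategory.tensorLeftIsoTensorRight w) Q)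

/-- The rotated triangle from `ihom_exact` carries a shift isomorphism on its second map; being
injective after `Q`, it does not affect the kernel. -/
lemma function_exact_ihom (Q : C ⥤ AddCommGrpCat.{v}) [Q.IsHomological] (w : C) {T : Triangle C}
    (hT : T ∈ distTriang C) :
    Function.Exact ((MonoidalClosed.internalHom.flip.obj w ⋙ Q).map T.mor₂.op).hom
      ((MonoidalClosed.internalHom.flip.obj w ⋙ Q).map T.mor₁.op).hom := by
  let e := (shiftNegShift ((ihom T.obj₁).obj w) (1 : ℤ)).inv
  have h : Function.Exact (Q.map ((MonoidalClosed.pre T.mor₂).app w)).hom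
      (Q.map ((MonoidalClosed.pre T.mor₁).app w ≫ e)).hom :=
    function_exact_of_isHomological Q
      (rot_of_distTriang _ (TensorTriangulated.ihom_exact T hT w))
  have he : Function.Injective (Q.map e).hom := ((isIso_iff_bijective_hom _).1 inferInstance).1
  have h' : Function.Exact (Q.map ((MonoidalClosed.pre T.mor₂).app w)).hom
      (Q.map ((MonoidalClosed.pre T.mor₁).app w)).hom := by
    intro y
    rw [← h y, Functor.map_comp]
    exact (map_eq_zero_iff _ he).symm
  exact h'

/-- If `Hom(d, - ⊗ w)` preserves products for every compact `d`, then
`hom(z, 𝟙) ⊗ w ⟶ hom(z, w)` is an isomorphism for all `z`. -/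
theorem isIso_dualTensorToHom_of_preserves (hC : IsRigidlyCompactlyGenerated C) (w : C)
    (hw : ∀ d : C, IsCompactObj d →
      PreservesAllProducts (tensorRight w ⋙ preadditiveCoyoneda.obj (op d))) (z : C) :
    IsIso (dualTensorToHom z w) := by
  have := hC.isCompactlyGenerated.hasCoproducts
  suffices h : ∀ n : ℤ, IsIso ((dualTensorToHomTrans w).app (op (z⟦n⟧))) from
    isIso_app_of_iso (dualTensorToHomTrans w) ((shiftFunctorZero C ℤ).app z).symm.op (h 0)
  refine hC.isCompactlyGenerated.induction
    (fun z => ∀ n : ℤ, IsIso ((dualTensorToHomTrans w).app (op (z⟦n⟧)))) ?_ ?_ ?_ ?_ z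
  · exact fun e h n => isIso_app_of_iso _ ((shiftFunctor C n).mapIso e).symm.op (h n)
  · exact fun x hx n => (hC.compact_iff_rigid _).1 (hx.shift n) w
  -- Both hom(-, 𝟙) and hom(-, w) turn coproducts into products; the hypothesis `hw` lets - ⊗ w keep
  -- them, as seen by Hom(d, -).
  · intro J X hX n
    rw [hC.isCompactlyGenerated.isIso_iff_isIso_map]
    intro d hd
    have := hw d hd J
    have : PreservesLimitsOfShape (Discrete J)ᵒᵖ
        (tensorRight w ⋙ preadditiveCoyoneda.obj (op d)) :=
      preservesLimitsOfShape_of_equiv (Discrete.opposite J).symm _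
    let G := (shiftFunctor C n).op ⋙ MonoidalClosed.internalHom.flip.obj (𝟙_ C) ⋙
      tensorRight w ⋙ preadditiveCoyoneda.obj (op d)
    have : PreservesLimitsOfShape (Discrete J)ᵒᵖ G := inferInstance
    let G' := (shiftFunctor C n).op ⋙ MonoidalClosed.internalHom.flip.obj w ⋙
      preadditiveCoyoneda.obj (op d)
    have : PreservesLimitsOfShape (Discrete J)ᵒᵖ G' := inferInstance
    let τ : G ⟶ G' := Functor.whiskerLeft (shiftFunctor C n).op
      (Functor.whiskerRight (dualTensorToHomTrans w) (preadditiveCoyoneda.obj (op d)))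
    refine isIso_app_of_isLimit τ (colimit.isColimit (Discrete.functor X)).op fun j => ?_
    have h : IsIso ((dualTensorToHomTrans w).app ((shiftFunctor C n).op.obj
      ((Discrete.functor X).op.obj j))) := hX j.unop.as n
    exact Functor.map_isIso (preadditiveCoyoneda.obj (op d)) _
  · intro T hT h₁ h₂ n
    have hT' := Triangle.shift_distinguished T hT n
    rw [hC.isCompactlyGenerated.isIso_iff_isIso_map]
    intro d _
    have := isHomological_tensorRight_comp w (preadditiveCoyoneda.obj (op d))
    let τ : MonoidalClosed.internalHom.flip.obj (𝟙_ C) ⋙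
        (tensorRight w ⋙ preadditiveCoyoneda.obj (op d)) ⟶
        MonoidalClosed.internalHom.flip.obj w ⋙ preadditiveCoyoneda.obj (op d) :=
      Functor.whiskerRight (dualTensorToHomTrans w) (preadditiveCoyoneda.obj (op d))
    have hd (y : C) (h : IsIso ((dualTensorToHomTrans w).app (op y))) : IsIso (τ.app (op y)) :=
      Functor.map_isIso (preadditiveCoyoneda.obj (op d)) _
    refine isIso_app_op_obj₃ (function_exact_ihom _ _) (function_exact_ihom _ _) τ hT'
      (hd _ (h₁ n)) (hd _ (h₂ n)) ?_ ?_
    · exact hd _ (isIso_app_of_iso _ ((shiftFunctorAdd C n 1).app T.obj₁).symm.op (h₁ (n + 1)))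
    · exact hd _ (isIso_app_of_iso _ ((shiftFunctorAdd C n 1).app T.obj₂).symm.op (h₂ (n + 1)))

end Contravariant

/-! ### Invertible objects and their integer powers -/

section Invertible

lemma isTensorInverse_unit (C : Type u) [Category.{v} C] [MonoidalCategory C] :
    IsTensorInverse (𝟙_ C) (𝟙_ C) :=
  ⟨λ_ _⟩

variable {C : Type u} [Category.{v} C] [MonoidalCategory C] [SymmetricCategory C]

lemma IsTensorInverse.symm {x x' : C} (h : IsTensorInverse x x') : IsTensorInverse x' x :=
  h.map fun e => β_ x' x ≪≫ e

/-- Tensoring by an invertible object is an equivalence. -/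
noncomputable def IsTensorInverse.equivalence {x x' : C} (h : IsTensorInverse x x') : C ≌ C :=
  .mk (tensorLeft x) (tensorLeft x')
    ((leftUnitorNatIso C).symm ≪≫ (curriedTensor C).mapIso h.symm.some.symm ≪≫
      tensorLeftTensor x' x)
    ((tensorLeftTensor x x').symm ≪≫ (curriedTensor C).mapIso h.some ≪≫ leftUnitorNatIso C)

/-- Tensoring by an invertible object is left adjoint to tensoring by its inverse. -/
noncomputable def IsTensorInverse.adjunction {x x' : C} (h : IsTensorInverse x x') :
    tensorLeft x ⊣ tensorLeft x' :=
  h.equivalence.toAdjunction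

lemma IsTensorInverse.tensor {x x' y y' : C} (h : IsTensorInverse x x')
    (h' : IsTensorInverse y y') : IsTensorInverse (x ⊗ y) (x' ⊗ y') := by
  obtain ⟨e⟩ := h
  obtain ⟨e'⟩ := h'
  exact ⟨α_ _ _ _ ≪≫ whiskerLeftIso x ((α_ _ _ _).symm ≪≫ whiskerRightIso (β_ y x') y' ≪≫
    α_ _ _ _) ≪≫ (α_ _ _ _).symm ≪≫ (e ⊗ᵢ e') ≪≫ λ_ _⟩

lemma isTensorInverse_tensorPow {x x' : C} (h : IsTensorInverse x x') (n : ℕ) :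
    IsTensorInverse (tensorPow x n) (tensorPow x' n) := by
  induction n with
  | zero => exact isTensorInverse_unit C
  | succ n ih => exact h.tensor ih

lemma isTensorInverse_tensorZPow {x x' : C} (h : IsTensorInverse x x') (n : ℤ) :
    IsTensorInverse (tensorZPow x x' n) (tensorZPow x x' (-n)) := by
  match n with
  | .ofNat 0 => exact isTensorInverse_unit C
  | .ofNat (m + 1) => exact isTensorInverse_tensorPow h (m + 1)
  | .negSucc m => exact isTensorInverse_tensorPow h.symm (m + 1)

lemma nonempty_tensorZPow_succ_iso {x x' : C} (h : IsTensorInverse x x') (n : ℤ) :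
    Nonempty (tensorZPow x x' n ⊗ x ≅ tensorZPow x x' (n + 1)) := by
  obtain ⟨e⟩ := h
  match n with
  | .ofNat m => exact ⟨β_ _ _⟩
  | .negSucc 0 =>
    exact ⟨β_ _ _ ≪≫ (α_ _ _ _).symm ≪≫ whiskerRightIso e _ ≪≫ λ_ _⟩
  | .negSucc (m + 1) =>
    exact ⟨β_ _ _ ≪≫ (α_ _ _ _).symm ≪≫ whiskerRightIso e _ ≪≫ λ_ _⟩

end Invertible

/-! ### Towers of adjoints -/

section Towers

variable {C : Type u₁} [Category.{v} C] {D : Type u₂} [Category.{v} D] {F : D ⥤ C}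

/-- Towers of adjoints are unique up to isomorphism. -/
lemma AdjointTower.nonempty_iso (T T' : AdjointTower F) (n : ℤ) :
    Nonempty (T.up n ≅ T'.up n) ∧ Nonempty (T.down n ≅ T'.down n) := by
  have down (n : ℤ) : Nonempty (T.up n ≅ T'.up n) → Nonempty (T.down (-n) ≅ T'.down (-n)) :=
    fun ⟨e⟩ => ⟨((T.adjUp n).ofNatIsoLeft e).rightAdjointUniq (T'.adjUp n)⟩
  have up (n : ℤ) : Nonempty (T.up n ≅ T'.up n) := by
    induction n using Int.induction_on with
    | zero => exact ⟨T.upZeroIso ≪≫ T'.upZeroIso.symm⟩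
    | succ n ih =>
      obtain ⟨e⟩ := down _ ih
      exact ⟨((T.adjDown n).ofNatIsoLeft e).rightAdjointUniq (T'.adjDown n)⟩
    | pred n ih =>
      -- Descending, uniqueness of left adjoints is used twice.
      obtain ⟨m, hm⟩ : ∃ m : ℤ, m = -(n : ℤ) - 1 := ⟨_, rfl⟩
      rw [← hm]
      replace ih : Nonempty (T.up (m + 1) ≅ T'.up (m + 1)) := by
        rwa [show m + 1 = -(n : ℤ) by lia]
      obtain ⟨e⟩ := ih
      have e' := ((T.adjDown m).ofNatIsoRight e).leftAdjointUniq (T'.adjDown m)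
      exact ⟨((T.adjUp m).ofNatIsoRight e').leftAdjointUniq (T'.adjUp m)⟩
  refine ⟨up n, ?_⟩
  simpa using down (-n) (up (-n))

lemma AdjointTower.isLeftAdjoint_up (T : AdjointTower F) (n : ℤ) : (T.up n).IsLeftAdjoint :=
  (T.adjUp n).isLeftAdjoint

lemma AdjointTower.isRightAdjoint_up (T : AdjointTower F) (n : ℤ) : (T.up n).IsRightAdjoint := by
  have := (T.adjDown (n - 1)).isRightAdjoint
  rwa [sub_add_cancel] at this

lemma AdjointTower.isLeftAdjoint_down (T : AdjointTower F) (n : ℤ) :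
    (T.down n).IsLeftAdjoint := by
  have := (T.adjDown (-n)).isLeftAdjoint
  rwa [neg_neg] at this

lemma AdjointTower.isRightAdjoint_down (T : AdjointTower F) (n : ℤ) :
    (T.down n).IsRightAdjoint := by
  have := (T.adjUp (-n)).isRightAdjoint
  rwa [neg_neg] at this

variable [MonoidalCategory C] [SymmetricCategory C] {R : C ⥤ D} {U : D ⥤ C}

/-- The tower of adjoints given by twisting with the powers of an invertible object. -/
noncomputable def twistTower (adj₂ : F ⊣ R) (adj₃ : R ⊣ U) {x x' : C} (h : IsTensorInverse x x')
    (e : U ≅ F ⋙ tensorLeft x) : AdjointTower F where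
  up n := F ⋙ tensorLeft (tensorZPow x x' n)
  down n := tensorLeft (tensorZPow x x' n) ⋙ R
  upZeroIso := Functor.isoWhiskerLeft F (leftUnitorNatIso C) ≪≫ F.rightUnitor
  adjUp n := adj₂.comp (isTensorInverse_tensorZPow h n).adjunction
  -- The right adjoint of R(x^{-n} ⊗ -) is x^n ⊗ U -, and U ≅ x ⊗ F - raises the exponent by one.
  adjDown n := ((isTensorInverse_tensorZPow h n).symm.adjunction.comp adj₃).ofNatIsoRight
    (Functor.isoWhiskerRight e _ ≪≫ Functor.associator _ _ _ ≪≫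
      Functor.isoWhiskerLeft F ((tensorLeftTensor _ _).symm ≪≫
        (curriedTensor C).mapIso (nonempty_tensorZPow_succ_iso h n).some))

end Towers

/-! ### Faithfulness and retracts -/

section Faithful

variable {C : Type u₁} [Category.{v} C] [Preadditive C] [HasZeroObject C] [HasShift C ℤ]
  [∀ n : ℤ, (shiftFunctor C n).Additive] [Pretriangulated C]
  {D : Type u₂} [Category.{v} D] {F : D ⥤ C} {R : C ⥤ D}

/-- Faithfulness makes the counit epi, and epis split in a triangulated category. Conversely, a
retraction F y ⟶ x factors through the counit at x, which is therefore epi. -/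
lemma faithful_iff_retract (adj : F ⊣ R) :
    R.Faithful ↔ ∀ x : C, ∃ y : D, Nonempty (Retract x (F.obj y)) := by
  refine ⟨fun _ x => ⟨R.obj x, ?_⟩, fun h => ?_⟩
  · have := isSplitEpi_of_epi (adj.counit.app x)
    exact ⟨section_ (adj.counit.app x), adj.counit.app x, IsSplitEpi.id _⟩
  · have (x : C) : Epi (adj.counit.app x) := by
      obtain ⟨y, ⟨r⟩⟩ := h x
      have h₁ : (F.map (adj.unit.app y) ≫ F.map (R.map r.r)) ≫ adj.counit.app x = r.r := by
        simp
      have : Epi ((F.map (adj.unit.app y) ≫ F.map (R.map r.r)) ≫ adj.counit.app x) := by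
        rw [h₁]
        infer_instance
      exact epi_of_epi (F.map (adj.unit.app y) ≫ F.map (R.map r.r)) _
    exact adj.faithful_R_of_epi_counit_app

end Faithful

/-! ### Formal consequences of F ≅ hom(w, U -) -/

section FormalWirthmuller

variable {C : Type u₁} [Category.{v} C] {D : Type u₂} [Category.{v} D]
  {F : D ⥤ C} {L R N : C ⥤ D} {U : D ⥤ C}

lemma AdjointTower.nonempty_down_neg_one_iso (T : AdjointTower F) (adj₂ : F ⊣ R) (adj₃ : R ⊣ U)
    (adj₄ : U ⊣ N) : Nonempty (T.down (-1) ≅ N) := by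
  have e₀ : T.down (-0) ≅ R := ((T.adjUp 0).ofNatIsoLeft T.upZeroIso).rightAdjointUniq adj₂
  have e₁ : T.up 1 ≅ U := ((T.adjDown 0).ofNatIsoLeft e₀).rightAdjointUniq adj₃
  exact ⟨((T.adjUp 1).ofNatIsoLeft e₁).rightAdjointUniq adj₄⟩

lemma PreservesAllProducts.of_iso {A : Type*} [Category.{v} A] {B : Type*} [Category.{v} B]
    {G G' : A ⥤ B} (e : G ≅ G') (h : PreservesAllProducts G) : PreservesAllProducts G' :=
  fun J => by
    have := h J
    exact preservesLimitsOfShape_of_natIso e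

variable [MonoidalCategory C] [SymmetricCategory C]

lemma IsTensorInverse.nonempty_iso_iff {A : Type*} [Category* A] {w w' : C}
    (h : IsTensorInverse w w') (G H : C ⥤ A) :
    Nonempty (G ≅ tensorLeft w ⋙ H) ↔ Nonempty (H ≅ tensorLeft w' ⋙ G) :=
  ⟨fun ⟨e⟩ => ⟨Iso.isoInverseComp (G := h.equivalence) e.symm⟩,
    fun ⟨e⟩ => ⟨Iso.isoInverseComp (G := h.symm.equivalence) e.symm⟩⟩

variable [MonoidalClosed C]

/-- If `F ≅ hom(w, U -)`, then the left adjoint of `F` is `R(w ⊗ -)`. -/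
noncomputable def leftAdjointIso (adj₁ : L ⊣ F) (adj₃ : R ⊣ U) {w : C} (e : F ≅ U ⋙ ihom w) :
    L ≅ tensorLeft w ⋙ R :=
  (adj₁.ofNatIsoRight e).leftAdjointUniq ((ihom.adjunction w).comp adj₃)

/-- If `F ≅ hom(w, U -)` and `w` is invertible, then `U ≅ w ⊗ F -`. -/
noncomputable def IsTensorInverse.isoOfIsoIhom {w w' : C} (h : IsTensorInverse w w')
    (e : F ≅ U ⋙ ihom w) : U ≅ F ⋙ tensorLeft w :=
  Iso.isoCompInverse (H := h.symm.equivalence) (Functor.isoWhiskerLeft U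
    (h.adjunction.rightAdjointUniq (ihom.adjunction w)) ≪≫ e.symm)

/-- An object `w` with `hom(w, w) ≅ 𝟙` is invertible if `hom(w, 𝟙) ⊗ w ⟶ hom(w, w)` is an
isomorphism. -/
lemma isTensorInvertible_of_isIso {w : C} (e : (ihom w).obj w ≅ 𝟙_ C)
    [IsIso (dualTensorToHom w w)] : IsTensorInvertible w :=
  ⟨(ihom w).obj (𝟙_ C), ⟨β_ _ _ ≪≫ asIso (dualTensorToHom w w) ≪≫ e⟩⟩

end FormalWirthmuller

/-! ### From products under R(w ⊗ -) to products under - ⊗ w -/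

section ProductPreservation

variable {C : Type u₁} [Category.{v} C] [Preadditive C] [HasZeroObject C] [HasBinaryBiproducts C]
  [MonoidalCategory C] [SymmetricCategory C]
  {D : Type u₂} [Category.{v} D] [Preadditive D] [HasZeroObject D] [MonoidalCategory D]
  {F : D ⥤ C} [F.Monoidal] {R : C ⥤ D}

/-- For `d` with dual `d'`, the functor `Hom(d, - ⊗ w)` is isomorphic to
`Hom(𝟙, R(w ⊗ (d' ⊗ -)))`, where `R` is right adjoint to a monoidal functor. -/
noncomputable def tensorRightCompCoyonedaIso (adj₂ : F ⊣ R) (w d' d : C) [ExactPairing d' d] :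
    tensorRight w ⋙ preadditiveCoyoneda.obj (op d) ≅
      tensorLeft d' ⋙ (tensorLeft w ⋙ R) ⋙ preadditiveCoyoneda.obj (op (𝟙_ D)) :=
  calc tensorRight w ⋙ preadditiveCoyoneda.obj (op d)
    _ ≅ tensorRight w ⋙ preadditiveCoyoneda.obj (op (d ⊗ 𝟙_ C)) :=
      Functor.isoWhiskerLeft _ (preadditiveCoyoneda.mapIso (ρ_ d).op)
    _ ≅ tensorRight w ⋙ tensorLeft d' ⋙ preadditiveCoyoneda.obj (op (𝟙_ C)) :=
      Functor.isoWhiskerLeft _ (preadditiveCoyonedaAdjIso (tensorLeftAdjunction d' d) (𝟙_ C))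
    _ ≅ (tensorRight w ⋙ tensorLeft d') ⋙ preadditiveCoyoneda.obj (op (F.obj (𝟙_ D))) :=
      (Functor.associator _ _ _).symm ≪≫
        Functor.isoWhiskerLeft _ (preadditiveCoyoneda.mapIso (Functor.Monoidal.εIso F).symm.op)
    _ ≅ (tensorLeft d' ⋙ tensorLeft w) ⋙ R ⋙ preadditiveCoyoneda.obj (op (𝟙_ D)) :=
      Functor.isoWhiskerLeft _ (preadditiveCoyonedaAdjIso adj₂ (𝟙_ D)) ≪≫
        Functor.isoWhiskerRight (NatIso.ofComponents
          (fun x => (α_ d' x w).symm ≪≫ β_ (d' ⊗ x) w)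
          fun f => by
            simp [-BraidedCategory.braiding_tensor_left_hom,
              ← BraidedCategory.braiding_naturality_left]) _
    _ ≅ tensorLeft d' ⋙ (tensorLeft w ⋙ R) ⋙ preadditiveCoyoneda.obj (op (𝟙_ D)) :=
      Functor.associator _ _ _ ≪≫ Functor.isoWhiskerLeft _ (Functor.associator _ _ _).symm

/-- If `R(w ⊗ -)` preserves products, then so does `Hom(d, - ⊗ w)` for every compact `d`. -/
lemma preservesAllProducts_tensorRight_comp [MonoidalClosed C]
    (hC : IsRigidlyCompactlyGenerated C) (adj₂ : F ⊣ R)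
    {w : C} (hw : PreservesAllProducts (tensorLeft w ⋙ R)) {d : C} (hd : IsCompactObj d) :
    PreservesAllProducts (tensorRight w ⋙ preadditiveCoyoneda.obj (op d)) := by
  obtain ⟨d', ⟨_⟩, -, -⟩ := hC.exists_exactPairing hd
  refine .of_iso (tensorRightCompCoyonedaIso adj₂ w d' d).symm fun J => ?_
  have := hw J
  have := (tensorLeftAdjunction d' d).isRightAdjoint
  infer_instance

end ProductPreservation

end TT

/-! ### The equivalent conditions -/

theorem mainTheorem2
    {C : Type u₁} [Category.{v} C] [Preadditive C] [HasZeroObject C] [HasShift C ℤ]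
    [∀ n : ℤ, (shiftFunctor C n).Additive] [Pretriangulated C] [IsTriangulated C]
    [MonoidalCategory C] [SymmetricCategory C] [MonoidalClosed C] [TT.TensorTriangulated C]
    {D : Type u₂} [Category.{v} D] [Preadditive D] [HasZeroObject D] [HasShift D ℤ]
    [∀ n : ℤ, (shiftFunctor D n).Additive] [Pretriangulated D] [IsTriangulated D]
    [MonoidalCategory D] [SymmetricCategory D] [MonoidalClosed D] [TT.TensorTriangulated D]
    (hC : TT.IsRigidlyCompactlyGenerated C) (hD : TT.IsRigidlyCompactlyGenerated D)
    -- the coproduct-preserving tensor-exact functor `f^*`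
    (fPull : D ⥤ C) [fPull.Braided] [fPull.CommShift ℤ] [fPull.IsTriangulated]
    (hf : TT.PreservesAllCoproducts fPull)
    -- the five adjoints `f_{(1)} ⊣ f^* ⊣ f_* ⊣ f^{(1)} ⊣ f_{(-1)}`
    (fLow1 : C ⥤ D) (fPush : C ⥤ D) (fUp1 : D ⥤ C) (fLowNeg1 : C ⥤ D)
    (adj₁ : fLow1 ⊣ fPull) (adj₂ : fPull ⊣ fPush) (adj₃ : fPush ⊣ fUp1)
    (adj₄ : fUp1 ⊣ fLowNeg1)
    -- the relative dualizing object
    (ω : C) (hω : ω = fUp1.obj (𝟙_ D)) :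
    -- the equivalent conditions
    List.TFAE [
      fLow1.IsRightAdjoint,
      TT.PreservesAllProducts fLow1,
      fLowNeg1.IsLeftAdjoint,
      TT.PreservesAllCoproducts fLowNeg1,
      TT.PreservesCompacts fUp1,
      TT.IsCompactObj ω,
      TT.IsTensorInvertible ω,
      ∃ w : C, TT.IsTensorInvertible w ∧ Nonempty (fLow1 ≅ tensorLeft w ⋙ fPush),
      ∃ w w' : C, TT.IsTensorInverse w w' ∧ Nonempty (fPush ≅ tensorLeft w' ⋙ fLow1),
      Nonempty (TT.AdjointTower fPull)] ∧
    -- the two forms of the Wirthmüller isomorphism are equivalent for each invertible object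
    (∀ w w' : C, TT.IsTensorInverse w w' →
      (Nonempty (fLow1 ≅ tensorLeft w ⋙ fPush) ↔ Nonempty (fPush ≅ tensorLeft w' ⋙ fLow1))) ∧
    -- all functors in a tower preserve coproducts, products and compact objects
    (∀ (T : TT.AdjointTower fPull) (n : ℤ),
      (TT.PreservesAllCoproducts (T.up n) ∧ TT.PreservesAllProducts (T.up n) ∧
        TT.PreservesCompacts (T.up n)) ∧
      (TT.PreservesAllCoproducts (T.down n) ∧ TT.PreservesAllProducts (T.down n) ∧
        TT.PreservesCompacts (T.down n))) ∧
    -- the tower is given by `f^{(n)} = ω^{⊗ n} ⊗ f^*` and `f_{(n)} = f_* (ω^{⊗ n} ⊗ -)`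
    (∀ (T : TT.AdjointTower fPull) (ω' : C), TT.IsTensorInverse ω ω' → ∀ n : ℤ,
      Nonempty (T.up n ≅ fPull ⋙ tensorLeft (TT.tensorZPow ω ω' n)) ∧
      Nonempty (T.down n ≅ tensorLeft (TT.tensorZPow ω ω' n) ⋙ fPush)) ∧
    -- `f_*` is faithful if and only if `f^*` is surjective up to direct summands
    (fPush.Faithful ↔ ∀ x : C, ∃ y : D, Nonempty (Retract x (fPull.obj y))) ∧
    -- the three sufficient conditions, in increasing generality
    (fPush.Faithful → ∀ x : C, TT.IsCompactObj (fPush.obj x) → TT.IsCompactObj x) ∧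
    ((∀ x : C, TT.IsCompactObj (fPush.obj x) → TT.IsCompactObj x) →
      ∀ x : C, (∀ y : C, TT.IsCompactObj y → TT.IsCompactObj (fPush.obj (x ⊗ y))) →
        TT.IsCompactObj x) ∧
    ((fPush.Faithful ∨
      (∀ x : C, TT.IsCompactObj (fPush.obj x) → TT.IsCompactObj x) ∨
      (∀ x : C, (∀ y : C, TT.IsCompactObj y → TT.IsCompactObj (fPush.obj (x ⊗ y))) →
        TT.IsCompactObj x)) →
      TT.IsCompactObj ω) := by
  subst hω
  have := adj₁.isRightAdjoint
  have := adj₁.isLeftAdjoint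
  have := adj₂.isLeftAdjoint
  have := adj₃.isLeftAdjoint
  have := adj₄.isLeftAdjoint
  have hPush : TT.PreservesAllCoproducts fPush := .of_isLeftAdjoint fPush
  let e := TT.isoIhomDualizing hC hD adj₂ adj₃ (.of_isLeftAdjoint fUp1)
  let eLow := TT.leftAdjointIso adj₁ adj₃ e
  -- This is hom(ω, ω) ≅ 𝟙, obtained by evaluating `e` at the unit.
  let eUnit := (e.app (𝟙_ D)).symm ≪≫ (Functor.Monoidal.εIso fPull).symm
  have faithful_imp (h : fPush.Faithful) (x : C) (hx : TT.IsCompactObj (fPush.obj x)) :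
      TT.IsCompactObj x := by
    have := isSplitEpi_of_epi (adj₂.counit.app x)
    exact (TT.PreservesCompacts.of_adjunction adj₂ hPush _ hx).of_retract
      ⟨section_ (adj₂.counit.app x), adj₂.counit.app x, IsSplitEpi.id _⟩
  have reflects_imp (h : ∀ x : C, TT.IsCompactObj (fPush.obj x) → TT.IsCompactObj x) (x : C)
      (hx : ∀ y : C, TT.IsCompactObj y → TT.IsCompactObj (fPush.obj (x ⊗ y))) :
      TT.IsCompactObj x :=
    h x ((hx _ hC.isCompactObj_unit).of_iso (fPush.mapIso (ρ_ x).symm))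
  have detects_imp (h : ∀ x : C, (∀ y : C, TT.IsCompactObj y →
      TT.IsCompactObj (fPush.obj (x ⊗ y))) → TT.IsCompactObj x) :
      TT.IsCompactObj (fUp1.obj (𝟙_ D)) :=
    h _ fun y hy => (TT.PreservesCompacts.of_adjunction adj₁ hf y hy).of_iso (eLow.app y).symm
  refine ⟨?_, fun w w' h => h.nonempty_iso_iff fLow1 fPush, fun T n => ⟨⟨?_, ?_, ?_⟩, ?_, ?_, ?_⟩,
    fun T ω' h n => T.nonempty_iso (TT.twistTower adj₂ adj₃ h (h.isoOfIsoIhom e)) n,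
    TT.faithful_iff_retract adj₂, faithful_imp, reflects_imp, ?_⟩
  · tfae_have 1 → 2 := fun _ => .of_isRightAdjoint fLow1
    tfae_have 2 → 7 := fun h => by
      have := TT.isIso_dualTensorToHom_of_preserves hC (fUp1.obj (𝟙_ D))
        (fun d hd => TT.preservesAllProducts_tensorRight_comp hC adj₂ (h.of_iso eLow) hd)
        (fUp1.obj (𝟙_ D))
      exact TT.isTensorInvertible_of_isIso eUnit
    tfae_have 3 → 4 := fun _ => .of_isLeftAdjoint fLowNeg1
    tfae_have 4 → 5 := fun h => .of_adjunction adj₄ h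
    tfae_have 5 → 6 := fun h => h _ hD.isCompactObj_unit
    tfae_have 6 → 7 := fun h => by
      have := (hC.compact_iff_rigid _).1 h (fUp1.obj (𝟙_ D))
      exact TT.isTensorInvertible_of_isIso eUnit
    tfae_have 7 → 8 := fun h => ⟨_, h, ⟨eLow⟩⟩
    tfae_have 8 → 9 := fun ⟨w, ⟨w', h⟩, e⟩ => ⟨w, w', h, (h.nonempty_iso_iff _ _).1 e⟩
    tfae_have 9 → 8 := fun ⟨w, w', h, e⟩ => ⟨w, ⟨w', h⟩, (h.nonempty_iso_iff _ _).2 e⟩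
    tfae_have 8 → 1 := fun ⟨w, ⟨w', h⟩, ⟨e⟩⟩ =>
      ((adj₂.comp h.symm.adjunction).ofNatIsoRight e.symm).isRightAdjoint
    tfae_have 7 → 10 := fun ⟨_, h⟩ => ⟨TT.twistTower adj₂ adj₃ h (h.isoOfIsoIhom e)⟩
    tfae_have 10 → 3 := fun ⟨T⟩ => by
      -- Three steps to the right of `fPull`, the tower must agree with `fLowNeg1`, and it continues
      -- to the right from there.
      obtain ⟨e⟩ := T.nonempty_down_neg_one_iso adj₂ adj₃ adj₄
      have := T.isLeftAdjoint_down (-1)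
      exact Functor.isLeftAdjoint_of_iso e
    tfae_finish
  · have := T.isLeftAdjoint_up n
    exact .of_isLeftAdjoint _
  · have := T.isRightAdjoint_up n
    exact .of_isRightAdjoint _
  · have := T.isLeftAdjoint_down (-n)
    exact .of_adjunction (T.adjUp n) (.of_isLeftAdjoint _)
  · have := T.isLeftAdjoint_down n
    exact .of_isLeftAdjoint _
  · have := T.isRightAdjoint_down n
    exact .of_isRightAdjoint _
  · have := T.isLeftAdjoint_up (-n + 1)
    have h := TT.PreservesCompacts.of_adjunction (T.adjDown (-n)) (.of_isLeftAdjoint _)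
    rwa [neg_neg] at h
  · rintro (h | h | h)
    · exact detects_imp (reflects_imp (faithful_imp h))
    · exact detects_imp (reflects_imp h)
    · exact detects_imp h
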